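/- Let $k$ be an algebraically closed field and let $X$ be a (reduced, complete) curve over $k$ that is the union of three smooth complete connected curves $X_1,X_2,X_3$, where $X_1$ and $X_2$ meet transversally at exactly one point $A$, $X_2$ and $X_3$ meet transversally at exactly one point $B\neq A$, and $X_1\cap X_3=\emptyset$. For $q=1,2,3$ let $X_q^c$ be the union of the two components other than $X_q$, and put $e_1=(-1,1,0)$, $e_2=(1,-2,1)$, $e_3=(0,1,-1)$. Fix integers $d,r\ge 0$. Let $\mathcal L_{\underline d}$, for $\underline d=(i,d-i-l,l)\ge \underline 0$, be invertible sheaves on $X$ of multidegree $\underline d$, linked, whenever $\underline d$ and $\underline d'=\underline d+e_q$ are both nonnegative, by maps $$\varphi_{\underline d,\underline d'}:\mathcal L_{\underline d}\to \mathcal L_{\underline d}|_{X_q^c}\cong \mathcal L_{\underline d'}|_{X_q^c}(-X_q\cap X_q^c)\hookrightarrow \mathcal L_{\underline d'},\qquad \varphi_{\underline d',\underline d}:\mathcal L_{\underline d'}\to \mathcal L_{\underline d'}|_{X_q}\cong \mathcal L_{\underline d}|_{X_q}(-X_q\cap X_q^c)\hookrightarrow \mathcal L_{\underline d}$$ (restriction,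 an isomorphism, inclusion), such that $\varphi_{\underline d^2,\underline d^3}\circ\varphi_{\underline d^1,\underline d^2}=\varphi_{\underline d^1,\underline d^3}$ whenever $\underline d^2=\underline d^1+e_{q_1}$ and $\underline d^3=\underline d^2+e_{q_2}$ with $q_1\ne q_2$. For arbitrary nonnegative $\underline d^0,\underline d$ of total degree $d$, let $\varphi_{\underline d^0,\underline d}$ be the composition of these maps along any path of nonnegative multidegrees from $\underline d^0$ to $\underline d$ with steps $\pm e_q$ that does not use all of $+e_1,+e_2,+e_3$, nor both $+e_q$ and $-e_q$ for some $q$, nor both $-e_{q_1}$ and $-e_{q_2}$ for some $q_1\neq q_2$ (such a path exists and the composition does not depend on it; $\varphi_{\underline d,\underline d}=\mathrm{id}$). Let $\{(\mathcal L_{\underline d},V_{\underline d})\}_{\underline d}$ be an exact limit linear series of degree $d$ and dimension $r$ on $X$, that is: $V_{\underline d}\subseteq H^0(X,\mathcal L_{\underline d})$ is a subspace of dimension $r+1$ for each $\underline d\geq\underline 0$ of total degree $d$, and, writing $V^{Y,0}$ for the subspace of the sections in $V$ that vanish on $Y$, whenever $\underline d$ and $\underline d'=\underline d+e_q$ are both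 nonnegative, $$\varphi_{\underline d,\underline d'}(V_{\underline d})=V_{\underline d'}^{X_q,0}\quad\text{and}\quad \varphi_{\underline d',\underline d}(V_{\underline d'})=V_{\underline d}^{X_q^c,0}.$$ Then the following statements are equivalent: 1. The limit linear series is simple: there are nonnegative multidegrees $\underline d^1,\dots,\underline d^m$ of total degree $d$ and linearly independent sections $s^\alpha_1,\dots,s^\alpha_{r_\alpha}\in V_{\underline d^\alpha}$ for $\alpha=1,\dots,m$, such that for every $\underline d$ the sections $\varphi_{\underline d^\alpha,\underline d}(s^\alpha_j)$, $1\le\alpha\le m$, $1\le j\le r_\alpha$, form a basis of $V_{\underline d}$. 2. $\displaystyle\sum_{\underline d}\dim\left(\frac{V_{\underline d}}{V_{\underline d}^{X_1,0}+V_{\underline d}^{X_2,0}+V_{\underline d}^{X_3,0}}\right)=r+1$, the sum being over all $\underline d\ge\underline 0$ of total degree $d$. 3. The distributivity holds in $V_{\underline d}$ for every $\underline d$, that is, $V_{\underline d}^{X_1,0}\cap(V_{\underline d}^{X_2,0}+V_{\underline d}^{X_3,0})=V_{\underline d}^{X_1,0}\cap V_{\underline d}^{X_2,0}+V_{\underline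 d}^{X_1,0}\cap V_{\underline d}^{X_3,0}$. -/

import Mathlib

open CategoryTheory AlgebraicGeometry TopologicalSpace

universe u

namespace LimitSeries

/-! ### Invertible sheaves and their sections -/

section Sections

variable {X : Scheme.{u}}

/-- The restriction of a section of a sheaf of modules to a smaller open set. -/
noncomputable def res (L : X.Modules) {U W : X.Opens} (h : W ≤ U) (s : Γ(L, U)) : Γ(L, W) :=
  L.presheaf.map (homOfLE h).op s

/-- `e ∈ Γ(W, L)` generates `L` over `W`: multiplication by `e` is an isomorphism
from the structure sheaf of `W` onto `L|_W`. -/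
def IsGenerator (L : X.Modules) {W : X.Opens} (e : Γ(L, W)) : Prop :=
  ∀ (U : X.Opens) (h : U ≤ W), Function.Bijective fun f : Γ(X, U) => f • res L h e

/-- An invertible sheaf: a sheaf of modules that is locally isomorphic to the structure sheaf. -/
def IsInvertibleSheaf (L : X.Modules) : Prop :=
  ∀ x : X, ∃ (W : X.Opens) (e : Γ(L, W)), x ∈ W ∧ IsGenerator L e

/-- The stalk of a sheaf of modules at a point. -/
noncomputable abbrev Stalk (L : X.Modules) (x : X) : Type u :=
  ↑(TopCat.Presheaf.stalk L.presheaf x)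

/-- The stalk `L_x` is a module over the local ring `O_{X,x}`. -/
noncomputable instance (L : X.Modules) (x : X) : Module (X.presheaf.stalk x) (Stalk L x) :=
  PresheafOfModules.instModuleCarrierStalkCommRingCatCarrierAbPresheafOpensCarrier
    (R := X.presheaf) L.val x

/-- The germ of a section at a point of its domain. -/
noncomputable def germ (L : X.Modules) {U : X.Opens} (x : X) (hx : x ∈ U) (s : Γ(L, U)) :
    Stalk L x :=
  TopCat.Presheaf.germ L.presheaf U x hx s

theorem germ_smul (L : X.Modules) {U : X.Opens} (x : X) (hx : x ∈ U) (f : Γ(X, U)) (s : Γ(L, U)) :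
    germ L x hx (f • s) = X.presheaf.germ U x hx f • germ L x hx s :=
  PresheafOfModules.germ_smul (R := X.presheaf) L.val x U hx f s

/-- The section `s` vanishes at the point `x`: its value in the fibre `L_x / 𝔪_x L_x` is zero. -/
def VanishesAt (L : X.Modules) {U : X.Opens} (s : Γ(L, U)) (x : X) (hx : x ∈ U) : Prop :=
  germ L x hx s ∈ IsLocalRing.maximalIdeal (X.presheaf.stalk x) •
    (⊤ : Submodule (X.presheaf.stalk x) (Stalk L x))

/-- The section `s` of `L` over `U` vanishes on (the part in `U` of) the reduced closed
subscheme with underlying set `Y`. -/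
def VanishesOn (L : X.Modules) {U : X.Opens} (s : Γ(L, U)) (Y : Set X) : Prop :=
  ∀ (x : X) (hx : x ∈ U), x ∈ Y → VanishesAt L s x hx

/-- For closed sets `Y` and `Z` covering a reduced scheme `X` and invertible sheaves `L` and `M`:
`φ : L ⟶ M` factors as `L → L|_Y ≅ M|_Y(-(Y ∩ Z)) ↪ M`, the first map being the restriction and
the last one the inclusion. Here `L|_Y` is the quotient of `L` by the subsheaf of sections
vanishing on `Y`, and `M|_Y(-(Y ∩ Z))` is the subsheaf of `M` of the sections vanishing on `Z`, so
that the factorization says what the kernel and the image of `φ` are, as sheaves. -/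
def FactorsThroughRestriction {L M : X.Modules} (φ : L ⟶ M) (Y Z : Set X) : Prop :=
  (∀ (U : X.Opens) (s : Γ(L, U)), φ.app U s = 0 ↔ VanishesOn L s Y) ∧
  (∀ (U : X.Opens) (t : Γ(M, U)), VanishesOn M t Z ↔
    ∀ x ∈ U, ∃ (W : X.Opens) (h : W ≤ U) (s : Γ(L, W)), x ∈ W ∧ φ.app W s = res M h t)

end Sections

/-! ### Degrees on curves -/

section Degree

variable {X C : Scheme.{u}} [IsIntegral C] [IsLocallyNoetherian C]

/-- Let `ι : C ⟶ X` be a closed integral subscheme and `s` a section of the invertible sheaf `L`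
over an open set that meets `C`; then `s|_C` is a rational section of `L|_C`. This says that its
order at `P ∈ C` is `n`: if `e` generates `L` near `P` and `s = f e`, then the rational function
`f|_C` on `C` has order `n` at `P`. -/
def HasOrderAt (ι : C ⟶ X) (L : X.Modules) {U : X.Opens} (s : Γ(L, U)) (P : C) (n : ℤ) : Prop :=
  ∃ (W : X.Opens) (e : Γ(L, W)) (f : Γ(X, U ⊓ W)) (_ : Nonempty (ι ⁻¹ᵁ (U ⊓ W))),
    ι P ∈ W ∧ IsGenerator L e ∧ res L inf_le_left s = f • res L inf_le_right e ∧
      Scheme.ord (C.germToFunctionField (ι ⁻¹ᵁ (U ⊓ W)) (ι.app (U ⊓ W) f)) P = n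

/-- The invertible sheaf `L|_C` has degree `n`, for a complete curve `C` over an algebraically
closed field and a closed immersion `ι : C ⟶ X`: the divisor `div (s|_C)` of a nonzero rational
section of `L|_C` (each of them is the restriction of a section `s` of `L` over an open set that
meets `C`) has degree `n`. On a complete curve all nonzero rational sections of an invertible sheaf
have divisors of the same degree, so it does not matter which of them is taken. -/
def HasDegreeOn (ι : C ⟶ X) (L : X.Modules) (n : ℤ) : Prop :=
  ∀ (U : X.Opens) (s : Γ(L, U)), (∃ (P : C) (hP : ι P ∈ U), ¬ VanishesAt L s (ι P) hP) →
    ∃ D : C →₀ ℤ, (∀ P : C, HasOrderAt ι L s P (D P)) ∧ (D.sum fun _ m => m) = n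

end Degree

/-! ### The curve -/

/-- A smooth complete (connected) curve over `k`. -/
structure IsSmoothCurve {k : Type u} [Field k] {C : Scheme.{u}} (p : C ⟶ Spec (.of k)) : Prop where
  integral : IsIntegral C
  proper : IsProper p
  smooth : Smooth p
  dim_eq_one : topologicalKrullDim C = 1

/-- A curve of compact type over `k` with three components in a chain: the union of three smooth
curves `X₁`, `X₂`, `X₃` (indexed by `0`, `1`, `2`), where `X₁` and `X₂` meet transversally at a
point `A` and nowhere else, `X₂` and `X₃` meet transversally at a point `B` and nowhere else, and
`X₁` and `X₃` do not meet. As the components are smooth and the union is reduced, transversality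
means that the scheme-theoretic intersections are reduced. -/
structure ChainCurve (k : Type u) [Field k] where
  /-- the curve -/
  X : Scheme.{u}
  /-- its structure morphism -/
  π : X ⟶ Spec (.of k)
  reduced : IsReduced X
  proper : IsProper π
  /-- the components -/
  comp : Fin 3 → Scheme.{u}
  /-- their inclusions -/
  ι : ∀ q, comp q ⟶ X
  closedImmersion : ∀ q, IsClosedImmersion (ι q)
  smoothCurve : ∀ q, IsSmoothCurve (ι q ≫ π)
  cover : ∀ x : X, ∃ q, x ∈ Set.range (ι q)
  /-- the point where the first two components meet -/
  A : X
  /-- the point where the last two components meet -/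
  B : X
  A_ne_B : A ≠ B
  inter_A : Set.range (ι 0) ∩ Set.range (ι 1) = {A}
  inter_B : Set.range (ι 1) ∩ Set.range (ι 2) = {B}
  inter_empty : Set.range (ι 0) ∩ Set.range (ι 2) = ∅
  transversal_A : IsReduced (Limits.pullback (ι 0) (ι 1))
  transversal_B : IsReduced (Limits.pullback (ι 1) (ι 2))

namespace ChainCurve

variable {k : Type u} [Field k] (X : ChainCurve k)

instance (q : Fin 3) : IsIntegral (X.comp q) := (X.smoothCurve q).integral

instance (q : Fin 3) : IsLocallyNoetherian (X.comp q) :=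
  haveI := (X.smoothCurve q).proper
  haveI : IsNoetherianRing (CommRingCat.of k) := inferInstanceAs (IsNoetherianRing k)
  LocallyOfFiniteType.isLocallyNoetherian (X.ι q ≫ X.π)

/-- The underlying closed set of the component with index `q`. -/
def component (q : Fin 3) : Set X.X := Set.range (X.ι q)

/-- The underlying closed set of the union of the components with index different from `q`
(the closure of the complement of the component with index `q`). -/
def coComponent (q : Fin 3) : Set X.X := {x | ∃ p, p ≠ q ∧ x ∈ X.component p}

/-- The inclusion of the constants into the global functions on `X`. -/
noncomputable def scalars : k →+* Γ(X.X, ⊤) :=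
  X.π.appTop.hom.comp (Scheme.ΓSpecIso (.of k)).inv.hom

/-- The space of global sections of a sheaf of modules on `X`. -/
def H0 (L : X.X.Modules) : Type u := Γ(L, ⊤)

noncomputable instance (L : X.X.Modules) : AddCommGroup (X.H0 L) :=
  inferInstanceAs (AddCommGroup Γ(L, ⊤))

noncomputable instance (L : X.X.Modules) : Module Γ(X.X, ⊤) (X.H0 L) :=
  inferInstanceAs (Module Γ(X.X, ⊤) Γ(L, ⊤))

noncomputable instance (L : X.X.Modules) : Module k (X.H0 L) := Module.compHom _ X.scalars

theorem smul_def (L : X.X.Modules) (c : k) (s : X.H0 L) :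
    c • s = (show Γ(L, ⊤) from X.scalars c • (show Γ(L, ⊤) from s)) := rfl

/-- The linear map on global sections induced by a morphism of sheaves. -/
noncomputable def H0map {L M : X.X.Modules} (φ : L ⟶ M) : X.H0 L →ₗ[k] X.H0 M where
  toFun s := φ.app ⊤ s
  map_add' s t := map_add (φ.app ⊤).hom s t
  map_smul' c s := Scheme.Modules.Hom.app_smul φ (X.scalars c) s

/-- `V^{Y,0}`: the subspace of the sections in `V` that vanish on `Y`. -/
noncomputable def vanishing {L : X.X.Modules} (V : Submodule k (X.H0 L)) (Y : Set X.X) :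
    Submodule k (X.H0 L) where
  carrier := {s | s ∈ V ∧ VanishesOn (U := ⊤) L s Y}
  zero_mem' := ⟨V.zero_mem, fun x hx _ => by
    have h : germ L (U := ⊤) x hx 0 = 0 := map_zero (TopCat.Presheaf.germ L.presheaf ⊤ x hx).hom
    exact (congrArg (· ∈ _) h).mpr (Submodule.zero_mem _)⟩
  add_mem' := fun {s t} hs ht => ⟨V.add_mem hs.1 ht.1, fun x hx hY => by
    have h : germ L (U := ⊤) x hx (show Γ(L, ⊤) from s + t) =
        germ L (U := ⊤) x hx s + germ L (U := ⊤) x hx t :=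
      map_add (TopCat.Presheaf.germ L.presheaf ⊤ x hx).hom s t
    exact (congrArg (· ∈ _) h).mpr (Submodule.add_mem _ (hs.2 x hx hY) (ht.2 x hx hY))⟩
  smul_mem' := fun c s hs => ⟨V.smul_mem c hs.1, fun x hx hY => by
    have h := germ_smul L (U := ⊤) x hx (X.scalars c) s
    exact (congrArg (· ∈ _) h).mpr (Submodule.smul_mem (IsLocalRing.maximalIdeal
      (X.X.presheaf.stalk x) • (⊤ : Submodule (X.X.presheaf.stalk x) (Stalk L x))) _
      (hs.2 x hx hY))⟩

end ChainCurve

/-! ### Multidegrees and paths -/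

/-- The nonnegative multidegrees of total degree `d`. -/
abbrev MultiDegree (d : ℕ) : Type := {a : Fin 3 → ℕ // ∑ q, a q = d}

instance (d : ℕ) : Fintype (MultiDegree d) :=
  Fintype.subtype (Finset.Nat.antidiagonalTuple 3 d) fun _ => Finset.Nat.mem_antidiagonalTuple

/-- The multidegree of the invertible sheaf `O_{(X_q)}`. -/
def twist : Fin 3 → Fin 3 → ℤ := ![![-1, 1, 0], ![1, -2, 1], ![0, 1, -1]]

/-- `b = a + multideg O_{(X_q)}`. -/
def IsTwist {d : ℕ} (q : Fin 3) (a b : MultiDegree d) : Prop :=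
  ∀ p, (b.1 p : ℤ) = a.1 p + twist q p

/-- A step of a path: `b = a + multideg O_{(X_q)}` or `a = b + multideg O_{(X_q)}`. -/
inductive Step {d : ℕ} : MultiDegree d → MultiDegree d → Type
  | up (q : Fin 3) {a b : MultiDegree d} (h : IsTwist q a b) : Step a b
  | down (q : Fin 3) {a b : MultiDegree d} (h : IsTwist q b a) : Step a b

/-- A path from a multidegree to another one (possibly of length zero). -/
inductive Path {d : ℕ} : MultiDegree d → MultiDegree d → Type
  | nil (a : MultiDegree d) : Path a a
  | cons {a b c : MultiDegree d} (e : Step a b) (p : Path b c) : Path a c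

/-- The step adds `multideg O_{(X_q)}`. -/
def Step.IsUp {d : ℕ} {a b : MultiDegree d} (q : Fin 3) : Step a b → Prop
  | .up q' _ => q = q'
  | .down _ _ => False

/-- The step subtracts `multideg O_{(X_q)}`. -/
def Step.IsDown {d : ℕ} {a b : MultiDegree d} (q : Fin 3) : Step a b → Prop
  | .up _ _ => False
  | .down q' _ => q = q'

/-- Some step of the path adds `multideg O_{(X_q)}`. -/
def Path.HasUp {d : ℕ} (q : Fin 3) : {a b : MultiDegree d} → Path a b → Prop
  | _, _, .nil _ => False
  | _, _, .cons e p => e.IsUp q ∨ p.HasUp q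

/-- Some step of the path subtracts `multideg O_{(X_q)}`. -/
def Path.HasDown {d : ℕ} (q : Fin 3) : {a b : MultiDegree d} → Path a b → Prop
  | _, _, .nil _ => False
  | _, _, .cons e p => e.IsDown q ∨ p.HasDown q

/-- The path satisfies none of the three conditions that make the composition of the linking maps
along it zero for trivial reasons: (I) it has a step `+ multideg O_{(X_q)}` for every `q`;
(II) for some `q` it has steps `+ multideg O_{(X_q)}` and `- multideg O_{(X_q)}`;
(III) for some `q₁ ≠ q₂` it has steps `- multideg O_{(X_{q₁})}` and `- multideg O_{(X_{q₂})}`. -/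
structure Path.IsAdmissible {d : ℕ} {a b : MultiDegree d} (p : Path a b) : Prop where
  notI : ¬ ∀ q, p.HasUp q
  notII : ¬ ∃ q, p.HasUp q ∧ p.HasDown q
  notIII : ¬ ∃ q₁ q₂, q₁ ≠ q₂ ∧ p.HasDown q₁ ∧ p.HasDown q₂

/-- Concatenation of paths. -/
def Path.append {d : ℕ} : {a b c : MultiDegree d} → Path a b → Path b c → Path a c
  | _, _, _, .nil _, p' => p'
  | _, _, _, .cons e p, p' => .cons e (p.append p')

theorem Path.hasUp_append {d : ℕ} {q : Fin 3} {a b c : MultiDegree d} (p : Path a b)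
    (p' : Path b c) : (p.append p').HasUp q ↔ p.HasUp q ∨ p'.HasUp q := by
  induction p with
  | nil a => simp [Path.append, Path.HasUp]
  | cons e p ih => simp [Path.append, Path.HasUp, ih, or_assoc]

theorem Path.hasDown_append {d : ℕ} {q : Fin 3} {a b c : MultiDegree d} (p : Path a b)
    (p' : Path b c) : (p.append p').HasDown q ↔ p.HasDown q ∨ p'.HasDown q := by
  induction p with
  | nil a => simp [Path.append, Path.HasDown]
  | cons e p ih => simp [Path.append, Path.HasDown, ih, or_assoc]

theorem sum_twist (q : Fin 3) : ∑ p, twist q p = 0 := by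
  fin_cases q <;> simp [twist, Fin.sum_univ_three]

theorem exists_between {d n : ℕ} {t : Fin 3 → ℤ} (ht : ∑ p, t p = 0) {a b : MultiDegree d}
    (h : ∀ p, (b.1 p : ℤ) = a.1 p + (n + 1 : ℕ) * t p) :
    ∃ c : MultiDegree d, (∀ p, (c.1 p : ℤ) = a.1 p + t p) ∧
      ∀ p, (b.1 p : ℤ) = c.1 p + n * t p := by
  have hnn : ∀ p, 0 ≤ (a.1 p : ℤ) + t p := fun p => by
    have h1 := h p
    have h2 : (0 : ℤ) ≤ a.1 p := Int.natCast_nonneg _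
    have h3 : (0 : ℤ) ≤ b.1 p := Int.natCast_nonneg _
    push_cast at h1
    by_contra hneg
    push Not at hneg
    nlinarith [mul_nonneg (Int.natCast_nonneg n) (show (0 : ℤ) ≤ - t p by linarith)]
  have hc : ∀ p, (((a.1 p : ℤ) + t p).toNat : ℤ) = a.1 p + t p := fun p => Int.toNat_of_nonneg (hnn p)
  refine ⟨⟨fun p => ((a.1 p : ℤ) + t p).toNat, ?_⟩, hc, fun p => ?_⟩
  · have hs : (∑ p, (a.1 p : ℤ)) = d := by exact_mod_cast a.2
    have : ((∑ p, ((a.1 p : ℤ) + t p).toNat : ℕ) : ℤ) = d := by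
      push_cast [hc]
      rw [Finset.sum_congr rfl fun p _ => by rw [← Int.toNat_of_nonneg (hnn p)]]
      simp only [hc, Finset.sum_add_distrib, ht, hs, add_zero]
    exact_mod_cast this
  · simp only [hc, h p]
    push_cast
    ring

theorem eq_of_forall_cast_eq {d : ℕ} {a b : MultiDegree d} (h : ∀ p, (b.1 p : ℤ) = a.1 p) :
    a = b :=
  Subtype.ext (funext fun p => by exact_mod_cast (h p).symm)

theorem exists_path_up {d : ℕ} (q : Fin 3) (n : ℕ) : ∀ a b : MultiDegree d,
    (∀ p, (b.1 p : ℤ) = a.1 p + n * twist q p) →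
      ∃ p : Path a b, (∀ q', p.HasUp q' → q' = q) ∧ ∀ q', ¬ p.HasDown q' := by
  induction n with
  | zero =>
    intro a b h
    obtain rfl := eq_of_forall_cast_eq (a := a) (b := b) fun p => by simpa using h p
    exact ⟨.nil a, fun _ h => False.elim h, fun _ h => h⟩
  | succ n ih =>
    intro a b h
    obtain ⟨c, hac, hcb⟩ := exists_between (sum_twist q) h
    obtain ⟨p, h1, h2⟩ := ih c b hcb
    exact ⟨.cons (.up q hac) p, fun q' h => Or.elim h id (h1 q'),
      fun q' h => Or.elim h id (h2 q')⟩

theorem exists_path_down {d : ℕ} (q : Fin 3) (n : ℕ) : ∀ a b : MultiDegree d,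
    (∀ p, (b.1 p : ℤ) = a.1 p + n * (- twist q p)) →
      ∃ p : Path a b, (∀ q', p.HasDown q' → q' = q) ∧ ∀ q', ¬ p.HasUp q' := by
  induction n with
  | zero =>
    intro a b h
    obtain rfl := eq_of_forall_cast_eq (a := a) (b := b) fun p => by simpa using h p
    exact ⟨.nil a, fun _ h => False.elim h, fun _ h => h⟩
  | succ n ih =>
    intro a b h
    obtain ⟨c, hac, hcb⟩ := exists_between (t := fun p => - twist q p)
      (by rw [Finset.sum_neg_distrib, sum_twist, neg_zero]) h
    obtain ⟨p, h1, h2⟩ := ih c b hcb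
    have he : IsTwist q c a := fun p => by rw [hac p]; ring
    exact ⟨.cons (.down q he) p, fun q' h => Or.elim h id (h1 q'),
      fun q' h => Or.elim h id (h2 q')⟩

theorem exists_path_up_down {d : ℕ} (q q' : Fin 3) (hq : q ≠ q') (n m : ℕ) (a b : MultiDegree d)
    (hc : ∀ p, 0 ≤ (a.1 p : ℤ) + n * twist q p)
    (h : ∀ p, (b.1 p : ℤ) = a.1 p + n * twist q p - m * twist q' p) :
    ∃ p : Path a b, p.IsAdmissible := by
  have hc' : ∀ p, (((a.1 p : ℤ) + n * twist q p).toNat : ℤ) = a.1 p + n * twist q p :=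
    fun p => Int.toNat_of_nonneg (hc p)
  have hs : (∑ p, (a.1 p : ℤ)) = d := by exact_mod_cast a.2
  let c : MultiDegree d := ⟨fun p => ((a.1 p : ℤ) + n * twist q p).toNat, by
    have : ((∑ p, ((a.1 p : ℤ) + n * twist q p).toNat : ℕ) : ℤ) = d := by
      rw [Nat.cast_sum]
      simp only [hc', Finset.sum_add_distrib, ← Finset.mul_sum, sum_twist, hs, mul_zero, add_zero]
    exact_mod_cast this⟩
  obtain ⟨p₁, h1, h2⟩ := exists_path_up q n a c hc'
  obtain ⟨p₂, h3, h4⟩ := exists_path_down q' m c b fun p => by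
    rw [h p, show (c.1 p : ℤ) = _ from hc' p]; ring
  have hu : ∀ x, (p₁.append p₂).HasUp x → x = q := fun x hx =>
    ((Path.hasUp_append _ _).mp hx).elim (h1 x) fun h => (h4 x h).elim
  have hd : ∀ x, (p₁.append p₂).HasDown x → x = q' := fun x hx =>
    ((Path.hasDown_append _ _).mp hx).elim (fun h => (h2 x h).elim) (h3 x)
  exact ⟨p₁.append p₂, fun h => hq (hu q' (h q')).symm,
    fun ⟨x, hx, hy⟩ => hq ((hu x hx).symm.trans (hd x hy)),
    fun ⟨x, y, hxy, hx, hy⟩ => hxy ((hd x hx).trans (hd y hy).symm)⟩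

/-- Any two multidegrees are connected by an admissible path. -/
theorem exists_admissible {d : ℕ} (a b : MultiDegree d) : ∃ p : Path a b, p.IsAdmissible := by
  have ha := a.2
  have hb := b.2
  rw [Fin.sum_univ_three] at ha hb
  rcases le_total (b.1 0) (a.1 0) with h0 | h0 <;> rcases le_total (b.1 2) (a.1 2) with h2 | h2
  · obtain ⟨p₁, hu1, hd1⟩ : ∃ p : Path a ⟨![b.1 0, a.1 1 + (a.1 0 - b.1 0), a.1 2], by
        simp [Fin.sum_univ_three]; omega⟩,
        (∀ q', p.HasUp q' → q' = 0) ∧ ∀ q', ¬ p.HasDown q' :=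
      exists_path_up 0 (a.1 0 - b.1 0) _ _ fun p => by
        fin_cases p <;> simp [twist] <;> omega
    obtain ⟨p₂, hu2, hd2⟩ := exists_path_up 2 (a.1 2 - b.1 2)
      (⟨![b.1 0, a.1 1 + (a.1 0 - b.1 0), a.1 2], by simp [Fin.sum_univ_three]; omega⟩) b fun p => by
        fin_cases p <;> simp [twist] <;> omega
    have hd : ∀ x, ¬ (p₁.append p₂).HasDown x := fun x hx =>
      ((Path.hasDown_append _ _).mp hx).elim (hd1 x) (hd2 x)
    refine ⟨p₁.append p₂, fun h => ?_, fun ⟨x, _, hx⟩ => hd x hx, fun ⟨x, _, _, hx, _⟩ => hd x hx⟩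
    rcases (Path.hasUp_append _ _).mp (h 1) with h | h
    · exact absurd (hu1 1 h) (by decide)
    · exact absurd (hu2 1 h) (by decide)
  · refine exists_path_up_down 0 2 (by decide) (a.1 0 - b.1 0) (b.1 2 - a.1 2) a b ?_ ?_ <;>
      intro p <;> fin_cases p <;> simp [twist] <;> omega
  · refine exists_path_up_down 2 0 (by decide) (a.1 2 - b.1 2) (b.1 0 - a.1 0) a b ?_ ?_ <;>
      intro p <;> fin_cases p <;> simp [twist] <;> omega
  · rcases le_total (b.1 0 - a.1 0) (b.1 2 - a.1 2) with h | h
    · refine exists_path_up_down 1 2 (by decide) (b.1 0 - a.1 0)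
        ((b.1 2 - a.1 2) - (b.1 0 - a.1 0)) a b ?_ ?_ <;>
        intro p <;> fin_cases p <;> simp [twist] <;> omega
    · refine exists_path_up_down 1 0 (by decide) (b.1 2 - a.1 2)
        ((b.1 0 - a.1 0) - (b.1 2 - a.1 2)) a b ?_ ?_ <;>
        intro p <;> fin_cases p <;> simp [twist] <;> omega

/-! ### Limit linear series -/

variable {k : Type u} [Field k]

/-- The invertible sheaves `L_a` of multidegree `a`, for all nonnegative multidegrees `a` of total
degree `d`, obtained from one of them by twisting with the sheaves `O_{(X_q)}`, together with the
linking maps between them. For `b = a + multideg O_{(X_q)}`, the map `up` is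
`L_a → L_a|_{X_q^c} ≅ L_b|_{X_q^c}(-(X_q ∩ X_q^c)) ↪ L_b` and the map `down` is
`L_b → L_b|_{X_q} ≅ L_a|_{X_q}(-(X_q ∩ X_q^c)) ↪ L_a`. These isomorphisms say that `L_b` has the
same restrictions to the three components as `L_a ⊗ O_{(X_q)}`, and on a curve of compact type the
restrictions determine an invertible sheaf up to isomorphism. -/
structure LinkedSheaves (X : ChainCurve k) (d : ℕ) where
  /-- the sheaves -/
  L : MultiDegree d → X.X.Modules
  invertible : ∀ a, IsInvertibleSheaf (L a)
  multidegree : ∀ a q, HasDegreeOn (X.ι q) (L a) (a.1 q)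
  /-- the linking maps from `a` to `a + multideg O_{(X_q)}` -/
  up : ∀ (q : Fin 3) {a b : MultiDegree d}, IsTwist q a b → (L a ⟶ L b)
  /-- the linking maps from `a + multideg O_{(X_q)}` to `a` -/
  down : ∀ (q : Fin 3) {a b : MultiDegree d}, IsTwist q a b → (L b ⟶ L a)
  up_factors : ∀ (q : Fin 3) {a b : MultiDegree d} (h : IsTwist q a b),
    FactorsThroughRestriction (up q h) (X.coComponent q) (X.component q)
  down_factors : ∀ (q : Fin 3) {a b : MultiDegree d} (h : IsTwist q a b),
    FactorsThroughRestriction (down q h) (X.component q) (X.coComponent q)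
  /-- if `b = a + multideg O_{(X_{q₁})}` and `c = b + multideg O_{(X_{q₂})}` with `q₁ ≠ q₂`, then
  `a = c + multideg O_{(X_{q₃})}` for the third index `q₃`, and the linking map from `a` to `c` is
  the composition of those from `a` to `b` and from `b` to `c` -/
  up_comp_up : ∀ (q₁ q₂ q₃ : Fin 3) {a b c : MultiDegree d} (h₁ : IsTwist q₁ a b)
    (h₂ : IsTwist q₂ b c) (h₃ : IsTwist q₃ c a), q₁ ≠ q₂ → q₁ ≠ q₃ → q₂ ≠ q₃ →
      up q₁ h₁ ≫ up q₂ h₂ = down q₃ h₃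

namespace LinkedSheaves

variable {X : ChainCurve k} {d : ℕ} (S : LinkedSheaves X d)

/-- The linking map of a step. -/
def stepMap {a b : MultiDegree d} : Step a b → (S.L a ⟶ S.L b)
  | .up q h => S.up q h
  | .down q h => S.down q h

/-- The composition of the linking maps along a path. -/
noncomputable def pathMap : {a b : MultiDegree d} → Path a b → (S.L a ⟶ S.L b)
  | _, _, .nil a => 𝟙 (S.L a)
  | _, _, .cons e p => S.stepMap e ≫ pathMap p

/-- The map `φ_{a,b} : L_a ⟶ L_b` for arbitrary multidegrees: the composition of the linking maps
along an admissible path from `a` to `b` (it does not depend on the path; for `a = b` the only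
admissible path is the one of length zero, and `φ_{a,a}` is the identity). -/
noncomputable def φ (a b : MultiDegree d) : S.L a ⟶ S.L b :=
  S.pathMap (exists_admissible a b).choose

end LinkedSheaves

/-- A limit linear series of degree `d` and dimension `r` on `X`. -/
structure LimitLinearSeries (X : ChainCurve k) (d r : ℕ) extends LinkedSheaves X d where
  /-- the spaces of sections -/
  V : ∀ a : MultiDegree d, Submodule k (X.H0 (L a))
  finrank_V : ∀ a, Module.finrank k (V a) = r + 1
  link_up : ∀ (q : Fin 3) {a b : MultiDegree d} (h : IsTwist q a b),
    (V a).map (X.H0map (up q h)) ≤ V b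
  link_down : ∀ (q : Fin 3) {a b : MultiDegree d} (h : IsTwist q a b),
    (V b).map (X.H0map (down q h)) ≤ V a

namespace LimitLinearSeries

variable {X : ChainCurve k} {d r : ℕ} (g : LimitLinearSeries X d r)

/-- `V_a^{X_q,0}`. -/
noncomputable def Vzero (a : MultiDegree d) (q : Fin 3) : Submodule k (X.H0 (g.L a)) :=
  X.vanishing (g.V a) (X.component q)

/-- Exactness: the images of the linking maps are as large as possible. -/
def IsExact : Prop :=
  ∀ (q : Fin 3) (a b : MultiDegree d) (h : IsTwist q a b),
    (g.V a).map (X.H0map (g.up q h)) = X.vanishing (g.V b) (X.component q) ∧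
    (g.V b).map (X.H0map (g.down q h)) = X.vanishing (g.V a) (X.coComponent q)

/-- The limit linear series is simple: it has a simple basis, that is, multidegrees
`δ 1, …, δ m` and linearly independent sections `s α 1, …, s α (ρ α)` in `V_{δ α}` whose images
under the maps `φ_{δ α, a}` together form a basis of `V_a`, for every `a`. -/
def IsSimple : Prop :=
  ∃ (m : ℕ) (δ : Fin m → MultiDegree d) (ρ : Fin m → ℕ)
    (s : ∀ α : Fin m, Fin (ρ α) → X.H0 (g.L (δ α))),
    (∀ α j, s α j ∈ g.V (δ α)) ∧ (∀ α, LinearIndependent k (s α)) ∧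
    ∀ a : MultiDegree d,
      LinearIndependent k
        (fun x : (Σ α : Fin m, Fin (ρ α)) => X.H0map (g.φ (δ x.1) a) (s x.1 x.2)) ∧
      Submodule.span k
        (Set.range fun x : (Σ α : Fin m, Fin (ρ α)) => X.H0map (g.φ (δ x.1) a) (s x.1 x.2)) =
        g.V a

/-- The dimension of `V_a / (V_a^{X_1,0} + V_a^{X_2,0} + V_a^{X_3,0})`. -/
noncomputable def quotientDim (a : MultiDegree d) : ℕ :=
  Module.finrank k
    (g.V a ⧸ Submodule.submoduleOf (g.Vzero a 0 ⊔ g.Vzero a 1 ⊔ g.Vzero a 2) (g.V a))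

/-- The distributivity holds in `V_a`. -/
def DistributivityHolds (a : MultiDegree d) : Prop :=
  g.Vzero a 0 ⊓ (g.Vzero a 1 ⊔ g.Vzero a 2) =
    (g.Vzero a 0 ⊓ g.Vzero a 1) ⊔ (g.Vzero a 0 ⊓ g.Vzero a 2)

end LimitLinearSeries

end LimitSeries

/-! Inclusion-exclusion gives the dimension of V_a/(V_a^{X_1,0} + V_a^{X_2,0} + V_a^{X_3,0}) as r +
1 - ∑_q dim V_a^{X_q,0} + ∑_q dim V_a^{X_q^c,0}, up to a defect δ_a ≥ 0 that is zero exactly when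
distributivity holds in V_a (`exists_quotientDim_eq`). By exactness and rank-nullity, dimensions in
neighbouring multidegrees are related, and the inclusion-exclusion number becomes a mixed second
difference on the triangle of pairs (i, l) (`inclusion_exclusion_eq_mixed_difference`). Its sum
telescopes to the boundary, where small degrees force sections to vanish, and equals r + 1
(`sum_inclusion_exclusion`). So the quotient dimensions always add up to r + 1 + ∑ δ_a. This proves
2 ⇔ 3, and the bound ≥ r + 1 in general.

1 ⇒ 2: a linking map between different multidegrees produces sections vanishing on some component.
In the quotient at a, only the basis sections that originate at a survive, so the quotient
dimensions add up to at most r + 1.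

2 ⇒ 1: lift bases of all the quotients. Each V_a^{X_q,0} is zero or lies in the image of a single
step (`Vzero_le_map_step`), so what the lifts at a miss comes from one step further back. This
regress ends: a path whose map does not kill all components has at most 6d steps (`Path.length_le`).
Hence the images of the lifts span every V_b, and there are r + 1 of them.

Geometry enters through the effect of linking maps on vanishing (`vanishesOn_up_iff`,
`vanishesOn_down_iff`), the bound of the number of zeros by the degree
(`vanishesOn_of_hasDegreeOn`), and reducedness of X. Independence of the path (`pathMap_eq_φ`) is
combinatorial: a path is admissible iff it spares some X_r, and paths sparing X_r are monotone in
suitable coordinates. -/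

namespace LimitSeries

/-! ### Vanishing of sections of invertible sheaves -/

section Vanishing

variable {X : Scheme.{u}} {L : X.Modules}

theorem germ_res (L : X.Modules) {U W : X.Opens} (h : W ≤ U) (s : Γ(L, U)) (x : X) (hx : x ∈ W) :
    germ L x hx (res L h s) = germ L x (h hx) s :=
  TopCat.Presheaf.germ_res_apply L.presheaf (homOfLE h) x hx s

theorem res_res (L : X.Modules) {U V W : X.Opens} (h : V ≤ U) (h' : W ≤ V) (s : Γ(L, U)) :
    res L h' (res L h s) = res L (h'.trans h) s := by
  have h1 := L.presheaf.map_comp (homOfLE h).op (homOfLE h').op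
  exact (ConcreteCategory.congr_hom h1 s).symm

theorem res_smul (L : X.Modules) {U W : X.Opens} (h : W ≤ U) (f : Γ(X, U)) (s : Γ(L, U)) :
    res L h (f • s) = X.presheaf.map (homOfLE h).op f • res L h s :=
  Scheme.Modules.map_smul L (homOfLE h) f s

theorem res_zero (L : X.Modules) {U W : X.Opens} (h : W ≤ U) : res L h (0 : Γ(L, U)) = 0 :=
  map_zero (L.presheaf.map (homOfLE h).op).hom

theorem res_self (L : X.Modules) {U : X.Opens} (h : U ≤ U) (s : Γ(L, U)) : res L h s = s := by
  have h1 := L.presheaf.map_id (Opposite.op U)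
  exact ConcreteCategory.congr_hom h1 s

theorem germ_zero (L : X.Modules) {U : X.Opens} (x : X) (hx : x ∈ U) :
    germ L x hx (0 : Γ(L, U)) = 0 :=
  map_zero (TopCat.Presheaf.germ L.presheaf U x hx).hom

theorem app_res {M : X.Modules} (φ : L ⟶ M) {U W : X.Opens} (h : W ≤ U) (s : Γ(L, U)) :
    φ.app W (res L h s) = res M h (φ.app U s) :=
  ConcreteCategory.congr_hom (φ.mapPresheaf.naturality (homOfLE h).op) s

theorem vanishesAt_res {U W : X.Opens} (h : W ≤ U) (s : Γ(L, U)) (x : X) (hx : x ∈ W) :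
    VanishesAt L (res L h s) x hx ↔ VanishesAt L s x (h hx) := by
  rw [VanishesAt, VanishesAt, germ_res]

theorem IsGenerator.restrict {U W : X.Opens} {e : Γ(L, U)} (he : IsGenerator L e) (h : W ≤ U) :
    IsGenerator L (res L h e) := by
  intro V hV
  simpa only [res_res] using he V (hV.trans h)

theorem IsGenerator.exists_smul_germ {W : X.Opens} {e : Γ(L, W)} (he : IsGenerator L e) {x : X}
    (hx : x ∈ W) (t : Stalk L x) : ∃ a : X.presheaf.stalk x, t = a • germ L x hx e := by
  obtain ⟨V, hVW, hV, s, rfl⟩ := TopCat.Presheaf.exists_le_germ_eq L.presheaf t hx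
  obtain ⟨f, hf⟩ := (he V (hVW)).2 s
  refine ⟨X.presheaf.germ V x hV f, ?_⟩
  rw [← germ_res L (hVW) e x hV, ← germ_smul]
  exact congrArg _ hf.symm

theorem IsGenerator.smul_germ_injective {W : X.Opens} {e : Γ(L, W)} (he : IsGenerator L e) {x : X}
    (hx : x ∈ W) {a : X.presheaf.stalk x} (ha : a • germ L x hx e = 0) : a = 0 := by
  obtain ⟨V, hVW, hV, f, rfl⟩ := TopCat.Presheaf.exists_le_germ_eq X.presheaf a hx
  rw [← germ_res L (hVW) e x hV, ← germ_smul, ← germ_zero L x hV] at ha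
  obtain ⟨V', hxV', i, j, h⟩ := TopCat.Presheaf.germ_eq L.presheaf x hV hV _ _ ha
  have h1 : res L (leOfHom i) (f • res L (hVW) e) = 0 :=
    h.trans (res_zero L (leOfHom j))
  rw [res_smul, res_res] at h1
  have h2 := (he V' ((leOfHom i).trans (hVW))).1 (h1.trans (zero_smul _ _).symm)
  have h3 := TopCat.Presheaf.germ_res_apply X.presheaf (homOfLE (leOfHom i)) x hxV' f
  exact h3.symm.trans ((congrArg _ h2).trans (map_zero (X.presheaf.germ V' x hxV').hom))

/-- The germ of `e` is a basis of the stalk, so 𝔪_x L_x consists of its multiples by elements of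
𝔪_x. -/
theorem IsGenerator.vanishesAt_smul_iff {W : X.Opens} {e : Γ(L, W)} (he : IsGenerator L e)
    (f : Γ(X, W)) {x : X} (hx : x ∈ W) : VanishesAt L (f • e) x hx ↔ x ∉ X.basicOpen f := by
  rw [X.mem_basicOpen f x hx, VanishesAt, germ_smul, ← mem_nonunits_iff,
    ← IsLocalRing.mem_maximalIdeal]
  refine ⟨fun h => ?_, fun h => Submodule.smul_mem_smul h trivial⟩
  have key : ∀ t ∈ IsLocalRing.maximalIdeal (X.presheaf.stalk x) •
      (⊤ : Submodule (X.presheaf.stalk x) (Stalk L x)),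
      ∃ a ∈ IsLocalRing.maximalIdeal (X.presheaf.stalk x), t = a • germ L x hx e := by
    intro t ht
    induction ht using Submodule.smul_induction_on' with
    | smul r hr n _ =>
      obtain ⟨b, rfl⟩ := he.exists_smul_germ hx n
      exact ⟨r * b, Ideal.mul_mem_right _ _ hr, (mul_smul _ _ _).symm⟩
    | add y _ z _ h1 h2 =>
      obtain ⟨a, ha, rfl⟩ := h1
      obtain ⟨b, hb, rfl⟩ := h2
      exact ⟨a + b, Ideal.add_mem _ ha hb, (add_smul _ _ _).symm⟩
  obtain ⟨a, ha, h2⟩ := key _ h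
  have h3 := he.smul_germ_injective hx
    (a := X.presheaf.germ W x hx f - a) (by rw [sub_smul, h2, sub_self])
  rwa [sub_eq_zero.mp h3]

theorem IsInvertibleSheaf.exists_local (hL : IsInvertibleSheaf L) {U : X.Opens} (s : Γ(L, U))
    {x : X} (hx : x ∈ U) : ∃ (W : X.Opens) (h : W ≤ U) (e : Γ(L, W)) (f : Γ(X, W)),
      x ∈ W ∧ IsGenerator L e ∧ res L h s = f • e := by
  obtain ⟨W, e, hxW, he⟩ := hL x
  obtain ⟨f, hf⟩ := (he (U ⊓ W) inf_le_right).2 (res L inf_le_left s)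
  exact ⟨U ⊓ W, inf_le_left, _, f, ⟨hx, hxW⟩, he.restrict inf_le_right, hf.symm⟩

theorem VanishesAt.of_specializes (hL : IsInvertibleSheaf L) {U : X.Opens} {s : Γ(L, U)}
    {x y : X} (hx : x ∈ U) (hy : y ∈ U) (h : y ⤳ x) (hs : VanishesAt L s y hy) :
    VanishesAt L s x hx := by
  obtain ⟨W, hW, e, f, hxW, he, hf⟩ := hL.exists_local s hx
  have hyW : y ∈ W := h.mem_open W.isOpen hxW
  rw [← vanishesAt_res hW s _ hxW, hf, he.vanishesAt_smul_iff f hxW]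
  rw [← vanishesAt_res hW s _ hyW, hf, he.vanishesAt_smul_iff f hyW] at hs
  exact fun h' => hs (h.mem_open (X.basicOpen f).isOpen h')

/-- Locally s = f e with `basicOpen f` empty, which forces f = 0 on a reduced scheme. -/
theorem eq_zero_of_vanishesOn [IsReduced X] (hL : IsInvertibleSheaf L) {U : X.Opens}
    {s : Γ(L, U)} (hs : ∀ (x : X) (hx : x ∈ U), VanishesAt L s x hx) : s = 0 := by
  refine TopCat.Presheaf.section_ext ⟨L.presheaf, L.isSheaf⟩ U s 0 fun x hx => ?_
  obtain ⟨W, hW, e, f, hxW, he, hf⟩ := hL.exists_local s hx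
  have hf0 : f = 0 := by
    rw [← basicOpen_eq_bot_iff, eq_bot_iff]
    intro y hy
    have hyW := X.basicOpen_le f hy
    have h := hs y (hW hyW)
    rw [← vanishesAt_res hW s _ hyW, hf, he.vanishesAt_smul_iff f hyW] at h
    exact (h hy).elim
  rw [hf0, zero_smul] at hf
  change germ L x hx s = germ L x hx 0
  rw [← germ_res L hW s x hxW, hf, germ_zero, germ_zero]

theorem vanishesAt_zero {U : X.Opens} (x : X) (hx : x ∈ U) : VanishesAt L (0 : Γ(L, U)) x hx := by
  rw [VanishesAt, germ_zero]
  exact Submodule.zero_mem _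

end Vanishing


theorem vanishesAt_of_generic {X C : Scheme.{u}} [IrreducibleSpace C] {ι : C ⟶ X}
    {L : X.Modules} (hL : IsInvertibleSheaf L) {U : X.Opens} {s : Γ(L, U)}
    {P : C} (hP : ι P ∈ U) (hη : ι (genericPoint C) ∈ U)
    (h : VanishesAt L s (ι (genericPoint C)) hη) : VanishesAt L s (ι P) hP :=
  h.of_specializes hL hP hη ((genericPoint_specializes P).map ι.continuous)

/-! ### Zeros of a section and its degree on a component -/

section Order

variable {C : Scheme.{u}} [IsIntegral C] [IsLocallyNoetherian C]

theorem ord_nonneg {U : C.Opens} [Nonempty U] {P : C} (hP : P ∈ U) {f : Γ(C, U)} (hf : f ≠ 0) :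
    0 ≤ Scheme.ord (C.germToFunctionField U f) P := by
  have h := Scheme.ord_le_smul hP hf (1 : C.functionField)
  have h1 : Scheme.ord (1 : C.functionField) P = 0 := by
    have := Scheme.ord_of_isUnit (isUnit_one (M := Γ(C, U))) hP
    rwa [map_one] at this
  rw [h1, Algebra.smul_def, mul_one] at h
  exact h

/-- The order is the length of O_{C,P}/(f), and this quotient is nonzero because f is not a unit at
P. -/
theorem one_le_ord {U : C.Opens} [Nonempty U] {P : C} (hP : P ∈ U) (hcP : Order.coheight P = 1)
    {f : Γ(C, U)} (hf : f ≠ 0) (hv : P ∉ C.basicOpen f) :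
    1 ≤ Scheme.ord (C.germToFunctionField U f) P := by
  have hdim : Ring.KrullDimLE 1 (C.presheaf.stalk P) := krullDimLE_of_coheight_le hcP.le
  have hg : C.presheaf.germ U P hP f ≠ 0 := fun h =>
    hf (germ_injective_of_isIntegral C P hP (h.trans (map_zero (C.presheaf.germ U P hP).hom).symm))
  have hF : C.germToFunctionField U f ≠ 0 := fun h =>
    hf (C.germToFunctionField_injective U (h.trans (map_zero _).symm))
  have hreg := mem_nonZeroDivisors_of_ne_zero hg
  obtain ⟨n, hn⟩ := ENat.ne_top_iff_exists.mp (Ring.ord_ne_top hreg)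
  have hn0 : n ≠ 0 := by
    rintro rfl
    have h0 : Module.length (C.presheaf.stalk P)
      (C.presheaf.stalk P ⧸ Ideal.span {C.presheaf.germ U P hP f}) = 0 := hn.symm
    rw [Module.length_eq_zero_iff, Ideal.Quotient.subsingleton_iff,
      Ideal.span_singleton_eq_top] at h0
    exact hv ((C.mem_basicOpen f P hP).mpr h0)
  have hord : Scheme.ord (C.germToFunctionField U f) P = n := by
    rw [Scheme.ord_eq_iff hcP hF, ← C.algebraMap_germ_eq_germToFunctionField hP]
    exact (Ring.ordFrac_eq_ord _ hg).trans (Ring.ordMonoidWithZeroHom_eq_coe _ hreg hn.symm)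
  rw [hord]
  exact_mod_cast Nat.one_le_iff_ne_zero.mpr hn0

variable {X : Scheme.{u}} {ι : C ⟶ X} {L : X.Modules}

theorem HasOrderAt.nonneg_and_pos (hL : IsInvertibleSheaf L) {U : X.Opens} {s : Γ(L, U)}
    {P₀ : C} (hP₀ : ι P₀ ∈ U) (h₀ : ¬ VanishesAt L s (ι P₀) hP₀) {P : C} (hP : ι P ∈ U) {n : ℤ}
    (h : HasOrderAt ι L s P n) :
    0 ≤ n ∧ (Order.coheight P = 1 → VanishesAt L s (ι P) hP → 1 ≤ n) := by
  obtain ⟨W, e, f, hne, hPW, he, hf, rfl⟩ := h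
  have hηU : ι (genericPoint C) ∈ U :=
    ((genericPoint_specializes P₀).map ι.continuous).mem_open U.isOpen hP₀
  have hηW : ι (genericPoint C) ∈ W :=
    ((genericPoint_specializes P).map ι.continuous).mem_open W.isOpen hPW
  have he' := he.restrict (inf_le_right : U ⊓ W ≤ W)
  have hbasic : ∀ (Q : C) (hQU : ι Q ∈ U), ι Q ∈ W →
      (VanishesAt L s (ι Q) hQU ↔ Q ∉ C.basicOpen (ι.app (U ⊓ W) f)) := by
    intro Q hQU hQW
    rw [← vanishesAt_res (inf_le_left : U ⊓ W ≤ U) s (ι Q) ⟨hQU, hQW⟩, hf,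
      he'.vanishesAt_smul_iff f ⟨hQU, hQW⟩, ← Scheme.preimage_basicOpen]
    rfl
  have hf0 : ι.app (U ⊓ W) f ≠ 0 := by
    intro h0
    refine h₀ (vanishesAt_of_generic hL hP₀ hηU ((hbasic _ hηU hηW).mpr ?_))
    rw [h0, Scheme.basicOpen_zero]
    exact id
  have hPUW : P ∈ ι ⁻¹ᵁ (U ⊓ W) := ⟨hP, hPW⟩
  exact ⟨ord_nonneg hPUW hf0, fun hc hv => one_le_ord hPUW hc hf0 ((hbasic P hP hPW).mp hv)⟩

/-- Otherwise the divisor of s on C would be effective of degree n and contain every point of T. -/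
theorem HasDegreeOn.vanishesAt_of_lt_card (hL : IsInvertibleSheaf L) {n : ℤ}
    (hdeg : HasDegreeOn ι L n) {s : Γ(L, ⊤)} (T : Finset C)
    (hT : ∀ P ∈ T, Order.coheight P = 1 ∧ VanishesAt L s (ι P) trivial) (hn : n < T.card)
    (P : C) : VanishesAt L s (ι P) trivial := by
  by_contra hP
  obtain ⟨D, hD, hsum⟩ := hdeg ⊤ s ⟨P, trivial, hP⟩
  have h0 : ∀ Q, 0 ≤ D Q := fun Q => ((hD Q).nonneg_and_pos hL (U := ⊤) trivial hP trivial).1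
  have h1 : ∀ Q ∈ T, 1 ≤ D Q := fun Q hQ =>
    ((hD Q).nonneg_and_pos hL (U := ⊤) trivial hP trivial).2 (hT Q hQ).1 (hT Q hQ).2
  have hsub : T ⊆ D.support := fun Q hQ => by
    have := h1 Q hQ
    rw [Finsupp.mem_support_iff]
    omega
  have h2 : (T.card : ℤ) ≤ D.sum fun _ m => m :=
    calc (T.card : ℤ) = ∑ _Q ∈ T, 1 := by simp
      _ ≤ ∑ Q ∈ T, D Q := Finset.sum_le_sum h1
      _ ≤ D.sum fun _ m => m := Finset.sum_le_sum_of_subset_of_nonneg hsub fun Q _ _ => h0 Q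
  omega

end Order

theorem coheight_eq_one_of_dim {C : Scheme.{u}} [IsIntegral C] (hdim : topologicalKrullDim C = 1)
    {P : C} (hP : P ≠ genericPoint C) : Order.coheight P = 1 := by
  have h1 : Order.krullDim C = 1 :=
    (Order.krullDim_eq_of_orderIso (irreducibleSetEquivPoints (α := C))).symm.trans hdim
  apply le_antisymm
  · have h := Order.coheight_le_krullDim P
    rw [h1] at h
    exact_mod_cast h
  · rw [Order.one_le_iff_pos, pos_iff_ne_zero, Ne, Order.coheight_eq_zero]
    intro hmax
    have h2 : P ⤳ genericPoint C := hmax (genericPoint_specializes P : P ≤ genericPoint C)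
    exact hP (h2.antisymm (genericPoint_specializes P)).eq

variable {k : Type u} [Field k]

/-! ### Components, their generic points, and maps factoring through a restriction -/

namespace ChainCurve

variable (X : ChainCurve k)

theorem isClosed_component (q : Fin 3) : IsClosed (X.component q) :=
  have := X.closedImmersion q
  (X.ι q).isClosedEmbedding.isClosed_range

theorem isClosed_A : IsClosed {X.A} := by
  rw [← X.inter_A]
  exact (X.isClosed_component 0).inter (X.isClosed_component 1)

theorem isClosed_B : IsClosed {X.B} := by
  rw [← X.inter_B]
  exact (X.isClosed_component 1).inter (X.isClosed_component 2)

/-- The generic point of a component. -/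
noncomputable def genericPt (q : Fin 3) : X.X := X.ι q (genericPoint (X.comp q))

theorem genericPt_mem (q : Fin 3) : X.genericPt q ∈ X.component q := ⟨_, rfl⟩

/-- A closed generic point would be the only point of its component, which has dimension one. -/
theorem ne_genericPt_of_isClosed {x : X.X} (hx : IsClosed {x}) (q : Fin 3) :
    x ≠ X.genericPt q := by
  rintro rfl
  have hsub : ∀ P Q : X.comp q, P = Q := by
    have h (P : X.comp q) : X.ι q P = X.genericPt q :=
      ((genericPoint_specializes P).map (X.ι q).continuous).mem_closed hx rfl
    have := X.closedImmersion q
    exact fun P Q => (X.ι q).isClosedEmbedding.injective ((h P).trans (h Q).symm)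
  have : Subsingleton (X.comp q) := ⟨hsub⟩
  have h1 : Order.krullDim (X.comp q) = 1 :=
    (Order.krullDim_eq_of_orderIso (irreducibleSetEquivPoints (α := X.comp q))).symm.trans
      (X.smoothCurve q).dim_eq_one
  have h2 : Order.krullDim (X.comp q) ≤ 0 := Order.krullDim_nonpos_of_subsingleton
  rw [h1] at h2
  exact absurd h2 (by decide)

theorem A_mem (q : Fin 3) (hq : q ≠ 2) : X.A ∈ X.component q := by
  have h : X.A ∈ X.component 0 ∩ X.component 1 := X.inter_A ▸ rfl
  fin_cases q
  · exact h.1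
  · exact h.2
  · exact (hq rfl).elim

theorem B_mem (q : Fin 3) (hq : q ≠ 0) : X.B ∈ X.component q := by
  have h : X.B ∈ X.component 1 ∩ X.component 2 := X.inter_B ▸ rfl
  fin_cases q
  · exact (hq rfl).elim
  · exact h.1
  · exact h.2

theorem eq_A_or_eq_B {p q : Fin 3} (hpq : p ≠ q) {x : X.X} (hp : x ∈ X.component p)
    (hq : x ∈ X.component q) : x = X.A ∨ x = X.B := by
  have hA : x ∈ X.component 0 → x ∈ X.component 1 → x = X.A := fun h0 h1 =>
    X.inter_A.subset ⟨h0, h1⟩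
  have hB : x ∈ X.component 1 → x ∈ X.component 2 → x = X.B := fun h0 h1 =>
    X.inter_B.subset ⟨h0, h1⟩
  have hE : x ∈ X.component 0 → x ∈ X.component 2 → False := fun h0 h1 =>
    X.inter_empty.subset ⟨h0, h1⟩
  fin_cases p <;> fin_cases q <;> first | exact (hpq rfl).elim | skip
  · exact .inl (hA hp hq)
  · exact (hE hp hq).elim
  · exact .inl (hA hq hp)
  · exact .inr (hB hp hq)
  · exact (hE hq hp).elim
  · exact .inr (hB hq hp)

theorem genericPt_notMem {p q : Fin 3} (hpq : p ≠ q) : X.genericPt p ∉ X.component q := by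
  intro h
  rcases X.eq_A_or_eq_B hpq (X.genericPt_mem p) h with h | h
  · exact X.ne_genericPt_of_isClosed X.isClosed_A p h.symm
  · exact X.ne_genericPt_of_isClosed X.isClosed_B p h.symm

/-- The complement of the union of the components other than the one with index `p`. -/
def openPart (p : Fin 3) : X.X.Opens where
  carrier := {x | ∀ q, q ≠ p → x ∉ X.component q}
  is_open' := by
    have : {x | ∀ q, q ≠ p → x ∉ X.component q} = ⋂ q, ⋂ (_ : q ≠ p), (X.component q)ᶜ := by
      ext x; simp
    rw [this]
    exact isOpen_iInter_of_finite fun q => isOpen_iInter_of_finite fun _ =>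
      (X.isClosed_component q).isOpen_compl

theorem genericPt_mem_openPart (p : Fin 3) : X.genericPt p ∈ X.openPart p :=
  fun _ hq => X.genericPt_notMem hq.symm

theorem mem_component_of_mem_openPart {p : Fin 3} {x : X.X} (hx : x ∈ X.openPart p) :
    x ∈ X.component p := by
  obtain ⟨q, hq⟩ := X.cover x
  by_cases h : q = p
  · exact h ▸ hq
  · exact (hx q h hq).elim

variable {X}

theorem vanishesOn_component_iff {L : X.X.Modules} (hL : IsInvertibleSheaf L) (q : Fin 3)
    (s : Γ(L, ⊤)) :
    VanishesOn L s (X.component q) ↔ VanishesAt L s (X.genericPt q) trivial := by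
  refine ⟨fun h => h _ trivial (X.genericPt_mem q), fun h x hx hq => ?_⟩
  obtain ⟨P, rfl⟩ := hq
  exact vanishesAt_of_generic hL hx (U := ⊤) trivial h

theorem eq_zero_of_vanishesOn_components {L : X.X.Modules} (hL : IsInvertibleSheaf L)
    {s : Γ(L, ⊤)} (h : ∀ q, VanishesOn L s (X.component q)) : s = 0 := by
  have := X.reduced
  exact eq_zero_of_vanishesOn hL fun x hx => (X.cover x).elim fun q hq => h q x hx hq

theorem vanishesOn_coComponent_iff {L : X.X.Modules} {q : Fin 3} {s : Γ(L, ⊤)} :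
    VanishesOn L s (X.coComponent q) ↔ ∀ p, p ≠ q → VanishesOn L s (X.component p) :=
  ⟨fun h p hp x hx hx' => h x hx ⟨p, hp, hx'⟩,
    fun h x hx ⟨p, hp, hx'⟩ => h p hp x hx hx'⟩

/-- `openPart p` lies in X_p, hence in Y, so φ is injective there: its kernel consists of sections
vanishing everywhere on a reduced scheme. It contains the generic point of X_p, where vanishing on
X_p can be tested. -/
theorem vanishesOn_map_iff_of_subset {L M : X.X.Modules} (hL : IsInvertibleSheaf L)
    (hM : IsInvertibleSheaf M) {φ : L ⟶ M} {Y Z : Set X.X} (hφ : FactorsThroughRestriction φ Y Z)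
    {p : Fin 3} (hp : X.component p ⊆ Y) (s : Γ(L, ⊤)) :
    VanishesOn M (φ.app ⊤ s) (X.component p) ↔ VanishesOn L s (X.component p) := by
  have := X.reduced
  have key : φ.app (X.openPart p) (res L le_top s) = 0 ↔
      VanishesOn L (res L (le_top : X.openPart p ≤ ⊤) s) Y := hφ.1 _ _
  constructor
  · intro h
    have h0 : φ.app (X.openPart p) (res L le_top s) = 0 := by
      rw [app_res]
      refine eq_zero_of_vanishesOn hM fun x hx => ?_
      rw [vanishesAt_res]
      exact h x trivial (X.mem_component_of_mem_openPart hx)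
    rw [vanishesOn_component_iff hL]
    have h1 := key.mp h0 _ (X.genericPt_mem_openPart p) (hp (X.genericPt_mem p))
    rwa [vanishesAt_res] at h1
  · intro h
    have h0 : φ.app (X.openPart p) (res L le_top s) = 0 := by
      refine key.mpr fun x hx _ => ?_
      rw [vanishesAt_res]
      exact h x trivial (X.mem_component_of_mem_openPart hx)
    rw [vanishesOn_component_iff hM]
    rw [app_res] at h0
    rw [← vanishesAt_res le_top _ _ (X.genericPt_mem_openPart p), h0]
    exact vanishesAt_zero _ _

theorem vanishesOn_map {L M : X.X.Modules} {φ : L ⟶ M} {Y Z : Set X.X}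
    (hφ : FactorsThroughRestriction φ Y Z) (s : Γ(L, ⊤)) : VanishesOn M (φ.app ⊤ s) Z :=
  (hφ.2 ⊤ _).mpr fun _ _ => ⟨⊤, le_rfl, s, trivial, (res_self M le_rfl _).symm⟩

theorem vanishesOn_of_hasDegreeOn {L : X.X.Modules} (hL : IsInvertibleSheaf L) {q : Fin 3} {n : ℤ}
    (hdeg : HasDegreeOn (X.ι q) L n) (T : Finset X.X) {s : Γ(L, ⊤)}
    (hT : ∀ x ∈ T, x ∈ X.component q ∧ IsClosed {x} ∧ VanishesAt L s x trivial)
    (hn : n < T.card) : VanishesOn L s (X.component q) := by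
  classical
  rintro _ - ⟨P, rfl⟩
  have := X.closedImmersion q
  have hinj : Function.Injective (X.ι q) := (X.ι q).isClosedEmbedding.injective
  refine hdeg.vanishesAt_of_lt_card hL (T.preimage (X.ι q) hinj.injOn) (fun Q hQ => ?_) ?_ P
  · obtain ⟨-, h1, h2⟩ := hT _ (Finset.mem_preimage.mp hQ)
    refine ⟨coheight_eq_one_of_dim (X.smoothCurve q).dim_eq_one ?_, h2⟩
    rintro rfl
    exact X.ne_genericPt_of_isClosed h1 q rfl
  · rwa [← Finset.card_image_of_injective _ hinj, Finset.image_preimage_of_bij]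
    exact ⟨fun _ hx => hx, hinj.injOn, fun x hx => by
      obtain ⟨Q, rfl⟩ := (hT x hx).1
      exact ⟨Q, hx, rfl⟩⟩

end ChainCurve

/-! ### Linking maps and vanishing; vanishing forced by small degrees -/

namespace LinkedSheaves

variable {X : ChainCurve k} {d : ℕ} (S : LinkedSheaves X d)

theorem vanishesOn_up_iff {q : Fin 3} {a b : MultiDegree d} (h : IsTwist q a b) (c : Fin 3)
    (s : Γ(S.L a, ⊤)) : VanishesOn (S.L b) ((S.up q h).app ⊤ s) (X.component c) ↔
      c = q ∨ VanishesOn (S.L a) s (X.component c) := by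
  by_cases hc : c = q
  · subst hc
    simpa using ChainCurve.vanishesOn_map (S.up_factors c h) s
  · simp only [hc, false_or]
    exact ChainCurve.vanishesOn_map_iff_of_subset (S.invertible a) (S.invertible b)
      (S.up_factors q h) (fun x hx => ⟨c, hc, hx⟩) s

theorem vanishesOn_down_iff {q : Fin 3} {a b : MultiDegree d} (h : IsTwist q a b) (c : Fin 3)
    (s : Γ(S.L b, ⊤)) : VanishesOn (S.L a) ((S.down q h).app ⊤ s) (X.component c) ↔
      c ≠ q ∨ VanishesOn (S.L b) s (X.component c) := by
  by_cases hc : c = q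
  · subst hc
    simp only [ne_eq, not_true_eq_false, false_or]
    exact ChainCurve.vanishesOn_map_iff_of_subset (S.invertible b) (S.invertible a)
      (S.down_factors c h) subset_rfl s
  · simp only [ne_eq, hc, not_false_eq_true, true_or, iff_true]
    exact ChainCurve.vanishesOn_coComponent_iff.mp
      (ChainCurve.vanishesOn_map (S.down_factors q h) s) c hc

theorem vanishesOn_zero_of_one {a : MultiDegree d} (ha : a.1 0 = 0) {s : Γ(S.L a, ⊤)}
    (h : VanishesOn (S.L a) s (X.component 1)) : VanishesOn (S.L a) s (X.component 0) :=
  ChainCurve.vanishesOn_of_hasDegreeOn (S.invertible a) (S.multidegree a 0) {X.A}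
    (by simpa using ⟨X.A_mem 0 (by decide), X.isClosed_A, h X.A trivial (X.A_mem 1 (by decide))⟩)
    (by simp [ha])

theorem vanishesOn_two_of_one {a : MultiDegree d} (ha : a.1 2 = 0) {s : Γ(S.L a, ⊤)}
    (h : VanishesOn (S.L a) s (X.component 1)) : VanishesOn (S.L a) s (X.component 2) :=
  ChainCurve.vanishesOn_of_hasDegreeOn (S.invertible a) (S.multidegree a 2) {X.B}
    (by simpa using ⟨X.B_mem 2 (by decide), X.isClosed_B, h X.B trivial (X.B_mem 1 (by decide))⟩)
    (by simp [ha])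

theorem vanishesOn_one_of_zero {a : MultiDegree d} (ha : a.1 1 = 0) {s : Γ(S.L a, ⊤)}
    (h : VanishesOn (S.L a) s (X.component 0)) : VanishesOn (S.L a) s (X.component 1) :=
  ChainCurve.vanishesOn_of_hasDegreeOn (S.invertible a) (S.multidegree a 1) {X.A}
    (by simpa using ⟨X.A_mem 1 (by decide), X.isClosed_A, h X.A trivial (X.A_mem 0 (by decide))⟩)
    (by simp [ha])

theorem vanishesOn_one_of_two {a : MultiDegree d} (ha : a.1 1 = 0) {s : Γ(S.L a, ⊤)}
    (h : VanishesOn (S.L a) s (X.component 2)) : VanishesOn (S.L a) s (X.component 1) :=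
  ChainCurve.vanishesOn_of_hasDegreeOn (S.invertible a) (S.multidegree a 1) {X.B}
    (by simpa using ⟨X.B_mem 1 (by decide), X.isClosed_B, h X.B trivial (X.B_mem 2 (by decide))⟩)
    (by simp [ha])

/-- The section has the two distinct zeros A and B on the middle component, where its degree is at
most one. -/
theorem vanishesOn_one_of_zero_of_two {a : MultiDegree d} (ha : a.1 1 ≤ 1) {s : Γ(S.L a, ⊤)}
    (h : VanishesOn (S.L a) s (X.component 0)) (h' : VanishesOn (S.L a) s (X.component 2)) :
    VanishesOn (S.L a) s (X.component 1) := by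
  classical
  refine ChainCurve.vanishesOn_of_hasDegreeOn (S.invertible a) (S.multidegree a 1) {X.A, X.B}
    ?_ ?_
  · intro x hx
    rcases Finset.mem_insert.mp hx with rfl | hx
    · exact ⟨X.A_mem 1 (by decide), X.isClosed_A, h _ trivial (X.A_mem 0 (by decide))⟩
    · rw [Finset.mem_singleton.mp hx]
      exact ⟨X.B_mem 1 (by decide), X.isClosed_B, h' _ trivial (X.B_mem 2 (by decide))⟩
  · rw [Finset.card_pair X.A_ne_B]
    omega

end LinkedSheaves

/-! ### Combinatorics of multidegrees and admissible paths -/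

section Paths

variable {d : ℕ}

theorem MultiDegree.sum_eq (a : MultiDegree d) : a.1 0 + a.1 1 + a.1 2 = d := by
  rw [← Fin.sum_univ_three]; exact a.2

theorem isTwist_zero_iff {a b : MultiDegree d} :
    IsTwist 0 a b ↔ b.1 0 + 1 = a.1 0 ∧ b.1 1 = a.1 1 + 1 ∧ b.1 2 = a.1 2 := by
  simp only [IsTwist, Fin.forall_fin_succ, twist]
  simp
  omega

theorem isTwist_one_iff {a b : MultiDegree d} :
    IsTwist 1 a b ↔ b.1 0 = a.1 0 + 1 ∧ b.1 1 + 2 = a.1 1 ∧ b.1 2 = a.1 2 + 1 := by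
  simp only [IsTwist, Fin.forall_fin_succ, twist]
  simp
  omega

theorem isTwist_two_iff {a b : MultiDegree d} :
    IsTwist 2 a b ↔ b.1 0 = a.1 0 ∧ b.1 1 = a.1 1 + 1 ∧ b.1 2 + 1 = a.1 2 := by
  simp only [IsTwist, Fin.forall_fin_succ, twist]
  simp
  omega

/-- The multidegree with given first and last entries. -/
def MultiDegree.mk' (i l : ℕ) (h : i + l ≤ d) : MultiDegree d :=
  ⟨![i, d - i - l, l], by simp [Fin.sum_univ_three]; omega⟩

@[simp] theorem MultiDegree.mk'_zero (i l : ℕ) (h : i + l ≤ d) : (mk' i l h).1 0 = i := rfl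
@[simp] theorem MultiDegree.mk'_one (i l : ℕ) (h : i + l ≤ d) : (mk' i l h).1 1 = d - i - l := rfl
@[simp] theorem MultiDegree.mk'_two (i l : ℕ) (h : i + l ≤ d) : (mk' i l h).1 2 = l := rfl

theorem MultiDegree.ext' {a b : MultiDegree d} (h0 : a.1 0 = b.1 0) (h2 : a.1 2 = b.1 2) :
    a = b := by
  have ha := a.sum_eq
  have hb := b.sum_eq
  refine Subtype.ext (funext fun p => ?_)
  fin_cases p
  · exact h0
  · show a.1 1 = b.1 1
    omega
  · exact h2

theorem IsTwist.target_unique {q : Fin 3} {a b c : MultiDegree d} (h : IsTwist q a b)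
    (h' : IsTwist q a c) : b = c :=
  eq_of_forall_cast_eq fun p => by rw [h p, h' p]

theorem IsTwist.source_unique {q : Fin 3} {a b c : MultiDegree d} (h : IsTwist q b a)
    (h' : IsTwist q c a) : b = c :=
  eq_of_forall_cast_eq fun p => by have := h p; have := h' p; omega

/-- If `a + e_p` and `a + e_q` are nonnegative, then so is `a + e_p + e_q = a - e_r`. -/
theorem IsTwist.exists_square {p q r : Fin 3} (hpq : p ≠ q) (hpr : p ≠ r) (hqr : q ≠ r)
    {a b c : MultiDegree d} (hb : IsTwist p a b) (hc : IsTwist q a c) :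
    ∃ e : MultiDegree d, IsTwist q b e ∧ IsTwist p c e ∧ IsTwist r e a := by
  have ha := a.sum_eq
  have hb' := b.sum_eq
  have hc' := c.sum_eq
  fin_cases p <;> fin_cases q <;> (try exact (hpq rfl).elim) <;>
  fin_cases r <;> first | exact (hpr rfl).elim | exact (hqr rfl).elim | skip
  all_goals
    simp only [Fin.zero_eta, Fin.mk_one, Fin.reduceFinMk, isTwist_zero_iff, isTwist_one_iff,
      isTwist_two_iff] at *
  · exact ⟨.mk' (a.1 0) (a.1 2 + 1) (by omega), by simp; omega⟩
  · exact ⟨.mk' (a.1 0 - 1) (a.1 2 - 1) (by omega), by simp; omega⟩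
  · exact ⟨.mk' (a.1 0) (a.1 2 + 1) (by omega), by simp; omega⟩
  · exact ⟨.mk' (a.1 0 + 1) (a.1 2) (by omega), by simp; omega⟩
  · exact ⟨.mk' (a.1 0 - 1) (a.1 2 - 1) (by omega), by simp; omega⟩
  · exact ⟨.mk' (a.1 0 + 1) (a.1 2) (by omega), by simp; omega⟩

theorem IsTwist.of_triangle {p q r : Fin 3} (hpq : p ≠ q) (hpr : p ≠ r) (hqr : q ≠ r)
    {a b c : MultiDegree d} (hb : IsTwist p a b) (hc : IsTwist r c a) : IsTwist q b c := by
  intro x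
  have hx : ∀ p q r : Fin 3, p ≠ q → p ≠ r → q ≠ r → ∀ x,
      twist p x + twist q x + twist r x = 0 := by decide
  have := hx p q r hpq hpr hqr x
  have := hb x
  have := hc x
  omega

/-- Coordinates `u` with `a = const + ∑ q, u q • e_q`, well-defined up to a common summand. -/
def MultiDegree.coord (a : MultiDegree d) : Fin 3 → ℤ := ![-a.1 0, 0, -a.1 2]

/-- The coordinate with respect to `e_p` in the coordinate system in which that with respect
to `e_r` is zero. -/
def MultiDegree.rel (r p : Fin 3) (a : MultiDegree d) : ℤ := a.coord p - a.coord r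

/-- As e_1 + e_2 + e_3 = 0, adding e_q raises coordinate q by one up to a common shift t, which
cancels in `rel`. The normalisation of `coord` makes t = -1 for the middle index and t = 0 for the
others. -/
theorem IsTwist.rel_eq {q : Fin 3} {a b : MultiDegree d} (h : IsTwist q a b) (r p : Fin 3) :
    b.rel r p = a.rel r p + (if p = q then 1 else 0) - (if r = q then 1 else 0) := by
  obtain ⟨t, ht⟩ : ∃ t, ∀ p, b.coord p = a.coord p + t + if p = q then 1 else 0 := by
    fin_cases q <;>
    simp only [Fin.zero_eta, Fin.mk_one, Fin.reduceFinMk, isTwist_zero_iff, isTwist_one_iff,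
      isTwist_two_iff] at h
    · exact ⟨0, fun p => by fin_cases p <;> simp [MultiDegree.coord] <;> omega⟩
    · exact ⟨-1, fun p => by fin_cases p <;> simp [MultiDegree.coord] <;> omega⟩
    · exact ⟨0, fun p => by fin_cases p <;> simp [MultiDegree.coord] <;> omega⟩
  rw [MultiDegree.rel, MultiDegree.rel, ht p, ht r]
  ring

theorem MultiDegree.rel_swap (r p : Fin 3) (a : MultiDegree d) : a.rel p r = - a.rel r p := by
  simp [MultiDegree.rel]

theorem MultiDegree.abs_rel_le (r p : Fin 3) (a : MultiDegree d) : |a.rel r p| ≤ d := by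
  have ha := a.sum_eq
  rw [abs_le]
  fin_cases r <;> fin_cases p <;> simp [MultiDegree.rel, MultiDegree.coord] <;> omega

/-- The images of the linking map of the step vanish on the component with index `c`. -/
def Step.Kills (c : Fin 3) {a b : MultiDegree d} : Step a b → Prop
  | .up q _ => c = q
  | .down q _ => c ≠ q

/-- The images of the composition of the linking maps along the path vanish on the component with
index `c`. -/
def Path.Kills (c : Fin 3) : {a b : MultiDegree d} → Path a b → Prop
  | _, _, .nil _ => False
  | _, _, .cons e p => e.Kills c ∨ p.Kills c

/-- The number of steps of a path. -/
def Path.length : {a b : MultiDegree d} → Path a b → ℕ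
  | _, _, .nil _ => 0
  | _, _, .cons _ p => p.length + 1

theorem Path.kills_iff (c : Fin 3) {a b : MultiDegree d} (p : Path a b) :
    p.Kills c ↔ p.HasUp c ∨ ∃ q, q ≠ c ∧ p.HasDown q := by
  induction p with
  | nil a => simp [Path.Kills, Path.HasUp, Path.HasDown]
  | cons e p ih =>
    cases e with
    | up q h => simp [Path.Kills, Path.HasUp, Path.HasDown, Step.IsUp, Step.IsDown, Step.Kills,
        ih, or_assoc]
    | down q h =>
      simp only [Path.Kills, Step.Kills, ih, Path.HasUp, Path.HasDown, Step.IsUp, Step.IsDown,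
        false_or]
      constructor
      · rintro (h | h | ⟨q', h, h'⟩)
        · exact .inr ⟨q, h.symm, .inl rfl⟩
        · exact .inl h
        · exact .inr ⟨q', h, .inr h'⟩
      · rintro (h | ⟨q', hne, rfl | h'⟩)
        · exact .inr (.inl h)
        · exact .inl hne.symm
        · exact .inr (.inr ⟨q', hne, h'⟩)

/-- If an admissible path has a step -e_q, then X_q is spared; if it has only steps up, some +e_r
does not occur, and X_r is spared. -/
theorem Path.isAdmissible_iff {a b : MultiDegree d} (p : Path a b) :
    p.IsAdmissible ↔ ∃ r, ¬ p.Kills r := by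
  simp only [Path.kills_iff]
  constructor
  · intro ⟨h1, h2, h3⟩
    by_cases hd : ∃ q, p.HasDown q
    · obtain ⟨q, hq⟩ := hd
      refine ⟨q, ?_⟩
      rintro (h | ⟨q', hne, hq'⟩)
      · exact h2 ⟨q, h, hq⟩
      · exact h3 ⟨q', q, hne, hq', hq⟩
    · push Not at h1 hd
      obtain ⟨r, hr⟩ := h1
      exact ⟨r, by rintro (h | ⟨q', -, hq'⟩); exacts [hr h, hd q' hq']⟩
  · rintro ⟨r, hr⟩
    push Not at hr
    obtain ⟨h1, h2⟩ := hr
    refine ⟨fun h => h1 (h r), ?_, ?_⟩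
    · rintro ⟨q, hu, hd⟩
      by_cases hq : q = r
      · exact h1 (hq ▸ hu)
      · exact h2 q hq hd
    · rintro ⟨q, q', hne, hq, hq'⟩
      by_cases h : q = r
      · exact h2 q' (fun h' => hne (h.trans h'.symm)) hq'
      · exact h2 q h hq

/-- A step sparing X_r is +e_q with q ≠ r, or -e_r, which is the sum of the other two e_q. With
coordinate r normalised to zero, no coordinate decreases. -/
theorem Step.rel_le {a b : MultiDegree d} {r : Fin 3} (e : Step a b) (he : ¬ e.Kills r)
    (p : Fin 3) : a.rel r p ≤ b.rel r p := by
  cases e with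
  | up q h =>
    have := h.rel_eq r p
    have hr : r ≠ q := he
    rw [if_neg hr] at this
    split_ifs at this <;> omega
  | down q h =>
    have := h.rel_eq r p
    have hr : r = q := not_not.mp he
    rw [if_pos hr] at this
    split_ifs at this <;> omega

theorem Step.rel_lt {a b : MultiDegree d} {r s : Fin 3} (e : Step a b) (he : ¬ e.Kills r)
    (hs : e.Kills s) : a.rel r s < b.rel r s := by
  cases e with
  | up q h =>
    have := h.rel_eq r s
    have hr : r ≠ q := he
    have hs : s = q := hs
    rw [if_neg hr, if_pos hs] at this
    omega
  | down q h =>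
    have := h.rel_eq r s
    have hr : r = q := not_not.mp he
    have hs : s ≠ q := hs
    rw [if_pos hr, if_neg hs] at this
    omega

theorem Step.exists_kills {a b : MultiDegree d} (e : Step a b) : ∃ s, e.Kills s := by
  cases e with
  | up q h => exact ⟨q, rfl⟩
  | down q h => exact ⟨q + 1, by revert q; simp [Step.Kills]⟩

theorem Path.rel_le {a b : MultiDegree d} {r : Fin 3} (π : Path a b) (hπ : ¬ π.Kills r)
    (p : Fin 3) : a.rel r p ≤ b.rel r p := by
  induction π with
  | nil a => exact le_rfl
  | cons e π ih =>
    rw [Path.Kills, not_or] at hπ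
    exact (e.rel_le hπ.1 p).trans (ih hπ.2)

theorem Path.rel_lt {a b : MultiDegree d} {r s : Fin 3} (π : Path a b) (hπ : ¬ π.Kills r)
    (hs : π.Kills s) : a.rel r s < b.rel r s := by
  induction π with
  | nil a => exact hs.elim
  | cons e π ih =>
    rw [Path.Kills, not_or] at hπ
    rcases hs with hs | hs
    · exact (e.rel_lt hπ.1 hs).trans_le (π.rel_le hπ.2 s)
    · exact (e.rel_le hπ.1 s).trans_lt (ih hπ.2 hs)

/-- A measure for the distance from `a` to `b` along paths that do not kill `r`. -/
def MultiDegree.size (r : Fin 3) (a : MultiDegree d) : ℤ := ∑ p, a.rel r p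

theorem Step.size_lt {a b : MultiDegree d} {r : Fin 3} (e : Step a b) (he : ¬ e.Kills r) :
    a.size r < b.size r := by
  obtain ⟨s, hs⟩ := e.exists_kills
  exact Finset.sum_lt_sum (fun p _ => e.rel_le he p) ⟨s, Finset.mem_univ _, e.rel_lt he hs⟩

theorem Path.size_add_length_le {a b : MultiDegree d} {r : Fin 3} (π : Path a b)
    (hπ : ¬ π.Kills r) : a.size r + π.length ≤ b.size r := by
  induction π with
  | nil a => simp [Path.length]
  | cons e π ih =>
    rw [Path.Kills, not_or] at hπ
    have h1 := e.size_lt hπ.1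
    have h2 := ih hπ.2
    rw [Path.length]
    push_cast
    omega

theorem MultiDegree.abs_size_le (r : Fin 3) (a : MultiDegree d) : |a.size r| ≤ 3 * d := by
  refine (Finset.abs_sum_le_sum_abs _ _).trans ?_
  refine (Finset.sum_le_sum fun p _ => a.abs_rel_le r p).trans ?_
  simp

/-- Each step raises `size r`, whose values lie between -3d and 3d. -/
theorem Path.length_le {a b : MultiDegree d} {r : Fin 3} (π : Path a b) (hπ : ¬ π.Kills r) :
    π.length ≤ 6 * d := by
  have h := π.size_add_length_le hπ
  have ha := abs_le.mp (a.abs_size_le r)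
  have hb := abs_le.mp (b.abs_size_le r)
  omega

/-- The endpoints decide which components an admissible path spares: killing r while sparing s makes
`rel s r` grow, whereas sparing r keeps its negative `rel r s` from decreasing. -/
theorem Path.kills_of_kills {a b : MultiDegree d} {r s : Fin 3} {π π' : Path a b}
    (hπ : ¬ π.Kills r) (hπ' : ¬ π'.Kills s) : ¬ π'.Kills r := by
  intro h
  have h1 := π'.rel_lt hπ' h
  have h2 := π.rel_le hπ s
  rw [MultiDegree.rel_swap r s, MultiDegree.rel_swap r s] at h1
  omega

theorem exists_path_not_kills {a b : MultiDegree d} (r : Fin 3)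
    (h : ∀ p, a.rel r p ≤ b.rel r p) : ∃ π : Path a b, ¬ π.Kills r := by
  obtain ⟨π, hπ⟩ := exists_admissible a b
  obtain ⟨s, hs⟩ := π.isAdmissible_iff.mp hπ
  refine ⟨π, fun hr => ?_⟩
  have h1 := π.rel_lt hs hr
  have h2 := h s
  rw [MultiDegree.rel_swap r s, MultiDegree.rel_swap r s] at h1
  omega

end Paths

/-! ### Independence of the composed linking map from the path -/

namespace LinkedSheaves

variable {X : ChainCurve k} {d : ℕ} (S : LinkedSheaves X d)

/-- Since -e_r = e_q + e_{q'}, the step down splits into two steps up, the first of which is shared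
with the other path. -/
theorem pathMap_eq_of_up_of_down {r q : Fin 3} {a b b₁ b₂ : MultiDegree d} (hq : r ≠ q)
    (h₁ : IsTwist q a b₁) (h₂ : IsTwist r b₂ a) (π₁ : Path b₁ b) (π₂ : Path b₂ b)
    (hπ₂ : ¬ π₂.Kills r)
    (ih : ∀ π : Path b₁ b, ¬ π.Kills r → S.pathMap π₁ = S.pathMap π) :
    S.up q h₁ ≫ S.pathMap π₁ = S.down r h₂ ≫ S.pathMap π₂ := by
  obtain ⟨q', h1, h2⟩ : ∃ q' : Fin 3, q ≠ q' ∧ q' ≠ r := by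
    clear * - hq; revert q r; decide
  have h := IsTwist.of_triangle h1 hq.symm h2 h₁ h₂
  rw [ih (.cons (.up q' h) π₂) (by rw [Path.Kills, not_or]; exact ⟨h2.symm, hπ₂⟩)]
  rw [← S.up_comp_up q q' r h₁ h h₂ h1 hq.symm h2, Category.assoc]
  rfl

theorem pathMap_eq_of_not_kills (r : Fin 3) (n : ℕ) : ∀ {a b : MultiDegree d} (π π' : Path a b),
    ¬ π.Kills r → ¬ π'.Kills r → b.size r ≤ a.size r + n → S.pathMap π = S.pathMap π' := by
  induction n with
  | zero =>
    intro a b π π' h h' hn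
    have h1 := π.size_add_length_le h
    have h2 := π'.size_add_length_le h'
    cases π with
    | cons e π => rw [Path.length] at h1; push_cast at *; omega
    | nil a =>
      cases π' with
      | cons e π => rw [Path.length] at h2; push_cast at *; omega
      | nil a => rfl
  | succ n ih =>
    intro a b π π' h h' hn
    have h1 := π.size_add_length_le h
    have h2 := π'.size_add_length_le h'
    cases π with
    | nil a =>
      cases π' with
      | cons e π => rw [Path.length] at h2; push_cast at *; omega
      | nil a => rfl
    | cons e₁ π₁ =>
    cases π' with
    | nil a => rw [Path.length] at h1; push_cast at *; omega
    | cons e₂ π₂ =>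
    rw [Path.Kills, not_or] at h h'
    have hs₁ := e₁.size_lt h.1
    have hs₂ := e₂.size_lt h'.1
    have ih₁ : ∀ π, ¬ π.Kills r → S.pathMap π₁ = S.pathMap π := fun π hπ =>
      ih π₁ π h.2 hπ (by push_cast at hn; omega)
    have ih₂ : ∀ π, ¬ π.Kills r → S.pathMap π₂ = S.pathMap π := fun π hπ =>
      ih π₂ π h'.2 hπ (by push_cast at hn; omega)
    cases e₁ with
    | up q₁ t₁ =>
      have hq₁ : r ≠ q₁ := h.1
      cases e₂ with
      | up q₂ t₂ =>
        have hq₂ : r ≠ q₂ := h'.1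
        by_cases hq : q₁ = q₂
        · subst hq
          obtain rfl := t₁.target_unique t₂
          rw [pathMap, pathMap, ih₁ π₂ h'.2]
        -- Here q₁, q₂, r are all the indices, and both paths are compared with one that starts with
        -- the step to c = a - e_r.
        · obtain ⟨c, hc₁, hc₂, hc⟩ := t₁.exists_square hq hq₁.symm hq₂.symm t₂
          obtain ⟨π₃, hπ₃⟩ : ∃ π : Path c b, ¬ π.Kills r := by
            -- Relative to r, c exceeds a by one in the coordinates q₁ and q₂ only; the first is
            -- bounded by that of b because of π₁, the second because of π₂.
            refine exists_path_not_kills r fun p => ?_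
            have e1 := π₁.rel_le h.2 p
            have e2 := π₂.rel_le h'.2 p
            rw [t₁.rel_eq r p, if_neg hq₁] at e1
            rw [t₂.rel_eq r p, if_neg hq₂] at e2
            rw [hc₁.rel_eq r p, if_neg hq₂, t₁.rel_eq r p, if_neg hq₁]
            split_ifs at * <;> omega
          rw [pathMap, pathMap, stepMap, stepMap,
            S.pathMap_eq_of_up_of_down hq₁ t₁ hc π₁ π₃ hπ₃ ih₁,
            S.pathMap_eq_of_up_of_down hq₂ t₂ hc π₂ π₃ hπ₃ ih₂]
      | down q₂ t₂ =>
        obtain rfl : r = q₂ := not_not.mp h'.1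
        exact S.pathMap_eq_of_up_of_down hq₁ t₁ t₂ π₁ π₂ h'.2 ih₁
    | down q₁ t₁ =>
      obtain rfl : r = q₁ := not_not.mp h.1
      cases e₂ with
      | up q₂ t₂ =>
        have hq₂ : r ≠ q₂ := h'.1
        exact (S.pathMap_eq_of_up_of_down hq₂ t₂ t₁ π₂ π₁ h.2 ih₂).symm
      | down q₂ t₂ =>
        obtain rfl : r = q₂ := not_not.mp h'.1
        obtain rfl := t₁.source_unique t₂
        rw [pathMap, pathMap, ih₁ π₂ h'.2]

theorem pathMap_eq_φ {r : Fin 3} {a b : MultiDegree d} (π : Path a b) (hπ : ¬ π.Kills r) :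
    S.pathMap π = S.φ a b := by
  obtain ⟨s, hs⟩ := (Path.isAdmissible_iff _).mp (exists_admissible a b).choose_spec
  refine S.pathMap_eq_of_not_kills r (b.size r - a.size r).toNat _ _ hπ
    (Path.kills_of_kills hπ hs) (by omega)

theorem vanishesOn_stepMap_iff {a b : MultiDegree d} (e : Step a b) (c : Fin 3)
    (s : Γ(S.L a, ⊤)) : VanishesOn (S.L b) ((S.stepMap e).app ⊤ s) (X.component c) ↔
      e.Kills c ∨ VanishesOn (S.L a) s (X.component c) := by
  cases e with
  | up q h => exact S.vanishesOn_up_iff h c s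
  | down q h => exact S.vanishesOn_down_iff h c s

theorem vanishesOn_pathMap_iff {a b : MultiDegree d} (π : Path a b) (c : Fin 3)
    (s : Γ(S.L a, ⊤)) : VanishesOn (S.L b) ((S.pathMap π).app ⊤ s) (X.component c) ↔
      π.Kills c ∨ VanishesOn (S.L a) s (X.component c) := by
  induction π with
  | nil a => rw [Path.Kills, false_or]; rfl
  | cons e π ih =>
    refine (ih ((S.stepMap e).app ⊤ s)).trans ?_
    rw [S.vanishesOn_stepMap_iff, Path.Kills]
    tauto

end LinkedSheaves

theorem finrank_map_add_finrank_of_mem_iff {k M N : Type*} [Field k] [AddCommGroup M] [Module k M]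
    [AddCommGroup N] [Module k N] (f : M →ₗ[k] N) (V K : Submodule k M) [FiniteDimensional k V]
    (hK : ∀ x, x ∈ K ↔ x ∈ V ∧ f x = 0) :
    Module.finrank k (V.map f) + Module.finrank k K = Module.finrank k V := by
  have h := LinearMap.finrank_range_add_finrank_ker (f.domRestrict V)
  rw [LinearMap.range_domRestrict] at h
  have hKV : K ≤ V := fun x hx => ((hK x).mp hx).1
  have h2 : LinearMap.ker (f.domRestrict V) = K.submoduleOf V := by
    ext x
    exact ⟨fun h => (hK x).mpr ⟨x.2, h⟩, fun h => ((hK x).mp h).2⟩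
  rw [h2, (Submodule.submoduleOfEquivOfLe hKV).finrank_eq] at h
  exact h

/-! ### Dimension relations from exactness, and the defect of distributivity -/

namespace LimitLinearSeries

variable {X : ChainCurve k} {d r : ℕ} (g : LimitLinearSeries X d r)

instance (a : MultiDegree d) : FiniteDimensional k (g.V a) :=
  Module.finite_of_finrank_pos (by rw [g.finrank_V]; omega)

/-- The sections in `V_a` that vanish on all components but possibly that with index `q`. -/
noncomputable def Vcozero (a : MultiDegree d) (q : Fin 3) : Submodule k (X.H0 (g.L a)) :=
  X.vanishing (g.V a) (X.coComponent q)

variable {g}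

theorem mem_Vcozero {a : MultiDegree d} {q : Fin 3} {s : X.H0 (g.L a)} :
    s ∈ g.Vcozero a q ↔ s ∈ g.V a ∧ ∀ p, p ≠ q → s ∈ g.Vzero a p :=
  and_congr_right fun h => ChainCurve.vanishesOn_coComponent_iff.trans
    (forall₂_congr fun _ _ => (and_iff_right h).symm)

theorem Vzero_le (a : MultiDegree d) (q : Fin 3) : g.Vzero a q ≤ g.V a := fun _ h => h.1

instance (a : MultiDegree d) (q : Fin 3) : FiniteDimensional k (g.Vzero a q) :=
  Submodule.finiteDimensional_of_le (Vzero_le a q)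

theorem eq_zero_of_mem_Vzero {a : MultiDegree d} {s : X.H0 (g.L a)}
    (h : ∀ q, s ∈ g.Vzero a q) : s = 0 :=
  ChainCurve.eq_zero_of_vanishesOn_components (g.invertible a) fun q => (h q).2

theorem Vzero_inf_Vzero {p q r' : Fin 3} (hpq : p ≠ q) (hpr : p ≠ r') (hqr : q ≠ r')
    (a : MultiDegree d) : g.Vzero a p ⊓ g.Vzero a q = g.Vcozero a r' := by
  ext s
  rw [Submodule.mem_inf, mem_Vcozero]
  have h : ∀ p q r : Fin 3, p ≠ q → p ≠ r → q ≠ r → ∀ x, x ≠ r → x = p ∨ x = q := by decide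
  constructor
  · rintro ⟨hp, hq⟩
    refine ⟨hp.1, fun x hx => ?_⟩
    rcases h p q r' hpq hpr hqr x hx with rfl | rfl
    exacts [hp, hq]
  · exact fun ⟨_, hs⟩ => ⟨hs p hpr, hs q hqr⟩

theorem H0map_up_eq_zero_iff {q : Fin 3} {a b : MultiDegree d} (h : IsTwist q a b)
    {s : X.H0 (g.L a)} (hs : s ∈ g.V a) : X.H0map (g.up q h) s = 0 ↔ s ∈ g.Vcozero a q :=
  ((g.up_factors q h).1 ⊤ s).trans (and_iff_right hs).symm

theorem H0map_up_mem_Vzero_iff {q : Fin 3} {a b : MultiDegree d} (h : IsTwist q a b)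
    {s : X.H0 (g.L a)} (hs : s ∈ g.V a) {p : Fin 3} (hp : p ≠ q) :
    X.H0map (g.up q h) s ∈ g.Vzero b p ↔ s ∈ g.Vzero a p := by
  have h1 := g.vanishesOn_up_iff h p s
  rw [or_iff_right hp] at h1
  exact ⟨fun h' => ⟨hs, h1.mp h'.2⟩,
    fun h' => ⟨g.link_up q h ⟨s, hs, rfl⟩, h1.mpr h'.2⟩⟩

theorem map_up (hg : g.IsExact) {q : Fin 3} {a b : MultiDegree d} (h : IsTwist q a b) :
    (g.V a).map (X.H0map (g.up q h)) = g.Vzero b q := (hg q a b h).1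

theorem map_down (hg : g.IsExact) {q : Fin 3} {a b : MultiDegree d} (h : IsTwist q a b) :
    (g.V b).map (X.H0map (g.down q h)) = g.Vcozero a q := (hg q a b h).2

/-- The linking map for e_q neither creates nor destroys vanishing on X_p when p ≠ q, so only the
vanishing on X_q is added. -/
theorem map_up_Vzero (hg : g.IsExact) {p q r' : Fin 3} (hpq : p ≠ q) (hpr : p ≠ r')
    (hqr : q ≠ r')
    {a b : MultiDegree d} (h : IsTwist q a b) :
    (g.Vzero a p).map (X.H0map (g.up q h)) = g.Vcozero b r' := by
  rw [← Vzero_inf_Vzero hpq hpr hqr]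
  ext t
  rw [Submodule.mem_inf, Submodule.mem_map, ← map_up hg h, Submodule.mem_map]
  constructor
  · rintro ⟨s, hs, rfl⟩
    exact ⟨(H0map_up_mem_Vzero_iff h hs.1 hpq).mpr hs, s, hs.1, rfl⟩
  · rintro ⟨ht, s, hs, rfl⟩
    exact ⟨s, (H0map_up_mem_Vzero_iff h hs hpq).mp ht, rfl⟩

theorem finrank_Vzero_add (hg : g.IsExact) {q : Fin 3} {a b : MultiDegree d} (h : IsTwist q a b) :
    Module.finrank k (g.Vzero b q) + Module.finrank k (g.Vcozero a q) = r + 1 := by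
  rw [← map_up hg h, ← g.finrank_V a]
  exact finrank_map_add_finrank_of_mem_iff _ _ _ fun s =>
    ⟨fun hs => ⟨hs.1, (H0map_up_eq_zero_iff h hs.1).mpr hs⟩,
      fun hs => (H0map_up_eq_zero_iff h hs.1).mp hs.2⟩

/-- Rank-nullity for the linking map restricted to V_a^{X_p,0}, which contains its whole kernel
V_a^{X_q^c,0}. -/
theorem finrank_Vzero_eq (hg : g.IsExact) {p q r' : Fin 3} (hpq : p ≠ q) (hpr : p ≠ r')
    (hqr : q ≠ r') {a b : MultiDegree d} (h : IsTwist q a b) :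
    Module.finrank k (g.Vcozero b r') + Module.finrank k (g.Vcozero a q) =
      Module.finrank k (g.Vzero a p) := by
  rw [← map_up_Vzero hg hpq hpr hqr h]
  exact finrank_map_add_finrank_of_mem_iff _ _ _ fun s =>
    ⟨fun hs => ⟨(mem_Vcozero.mp hs).2 p hpq, (H0map_up_eq_zero_iff h hs.1).mpr hs⟩,
      fun hs => (H0map_up_eq_zero_iff h hs.1.1).mp hs.2⟩

theorem Vcozero_eq_bot_of_le {a : MultiDegree d} {q : Fin 3}
    (h : ∀ s : X.H0 (g.L a), (∀ p, p ≠ q → s ∈ g.Vzero a p) → s ∈ g.Vzero a q) :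
    g.Vcozero a q = ⊥ := by
  rw [eq_bot_iff]
  intro s hs
  have hs' := (mem_Vcozero.mp hs).2
  refine eq_zero_of_mem_Vzero fun p => ?_
  by_cases hp : p = q
  · exact hp ▸ h s hs'
  · exact hs' p hp

theorem Vzero_one_le_zero {a : MultiDegree d} (ha : a.1 0 = 0) : g.Vzero a 1 ≤ g.Vzero a 0 :=
  fun _ hs => ⟨hs.1, g.vanishesOn_zero_of_one ha hs.2⟩

theorem Vzero_one_le_two {a : MultiDegree d} (ha : a.1 2 = 0) : g.Vzero a 1 ≤ g.Vzero a 2 :=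
  fun _ hs => ⟨hs.1, g.vanishesOn_two_of_one ha hs.2⟩

theorem Vzero_zero_le_one {a : MultiDegree d} (ha : a.1 1 = 0) : g.Vzero a 0 ≤ g.Vzero a 1 :=
  fun _ hs => ⟨hs.1, g.vanishesOn_one_of_zero ha hs.2⟩

theorem Vzero_two_le_one {a : MultiDegree d} (ha : a.1 1 = 0) : g.Vzero a 2 ≤ g.Vzero a 1 :=
  fun _ hs => ⟨hs.1, g.vanishesOn_one_of_two ha hs.2⟩

theorem Vcozero_zero_eq_bot {a : MultiDegree d} (ha : a.1 0 = 0) : g.Vcozero a 0 = ⊥ :=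
  Vcozero_eq_bot_of_le fun _ h => Vzero_one_le_zero ha (h 1 (by decide))

theorem Vcozero_two_eq_bot {a : MultiDegree d} (ha : a.1 2 = 0) : g.Vcozero a 2 = ⊥ :=
  Vcozero_eq_bot_of_le fun _ h => Vzero_one_le_two ha (h 1 (by decide))

theorem Vcozero_one_eq_bot {a : MultiDegree d} (ha : a.1 1 ≤ 1) : g.Vcozero a 1 = ⊥ :=
  Vcozero_eq_bot_of_le fun _ h => ⟨(h 0 (by decide)).1,
    g.vanishesOn_one_of_zero_of_two ha (h 0 (by decide)).2 (h 2 (by decide)).2⟩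

theorem Vzero_sup_le (a : MultiDegree d) : g.Vzero a 0 ⊔ g.Vzero a 1 ⊔ g.Vzero a 2 ≤ g.V a :=
  sup_le (sup_le (Vzero_le a 0) (Vzero_le a 1)) (Vzero_le a 2)

theorem quotientDim_add_finrank (a : MultiDegree d) :
    g.quotientDim a +
      Module.finrank k ↥(g.Vzero a 0 ⊔ g.Vzero a 1 ⊔ g.Vzero a 2) = r + 1 := by
  rw [← g.finrank_V a, ← (Submodule.submoduleOfEquivOfLe (Vzero_sup_le a)).finrank_eq]
  exact Submodule.finrank_quotient_add_finrank _

/-- The dimension of `V_a / (V_a^{X_1,0} + V_a^{X_2,0} + V_a^{X_3,0})` is given by the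
inclusion-exclusion formula up to a defect, which vanishes if and only if distributivity holds. -/
theorem exists_quotientDim_eq (a : MultiDegree d) : ∃ δ : ℕ,
    (g.quotientDim a : ℤ) = (r + 1 - ∑ q, (Module.finrank k (g.Vzero a q) : ℤ) +
      ∑ q, (Module.finrank k (g.Vcozero a q) : ℤ)) + δ ∧ (δ = 0 ↔ g.DistributivityHolds a) := by
  have h1 := quotientDim_add_finrank (g := g) a
  rw [sup_assoc] at h1
  have h2 := Submodule.finrank_sup_add_finrank_inf_eq (g.Vzero a 0) (g.Vzero a 1 ⊔ g.Vzero a 2)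
  have h3 := Submodule.finrank_sup_add_finrank_inf_eq (g.Vzero a 1) (g.Vzero a 2)
  have h4 := Submodule.finrank_sup_add_finrank_inf_eq (g.Vzero a 0 ⊓ g.Vzero a 1)
    (g.Vzero a 0 ⊓ g.Vzero a 2)
  -- No nonzero section vanishes on all components, so the sum on the right of the distributive law
  -- is direct.
  have h5 : g.Vzero a 0 ⊓ g.Vzero a 1 ⊓ (g.Vzero a 0 ⊓ g.Vzero a 2) = ⊥ := by
    rw [eq_bot_iff]
    rintro s ⟨⟨h0, h1⟩, -, h2⟩
    exact eq_zero_of_mem_Vzero (g := g) fun q => by fin_cases q; exacts [h0, h1, h2]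
  have hle : (g.Vzero a 0 ⊓ g.Vzero a 1) ⊔ (g.Vzero a 0 ⊓ g.Vzero a 2) ≤
      g.Vzero a 0 ⊓ (g.Vzero a 1 ⊔ g.Vzero a 2) := le_inf_sup
  have : FiniteDimensional k ↥(g.Vzero a 0 ⊓ (g.Vzero a 1 ⊔ g.Vzero a 2)) :=
    Submodule.finiteDimensional_of_le (inf_le_left.trans (Vzero_le a 0))
  have h6 := Submodule.finrank_mono hle
  rw [h5, finrank_bot, add_zero] at h4
  have h7 := Submodule.eq_of_le_of_finrank_eq hle
  rw [Vzero_inf_Vzero (g := g) (p := 1) (q := 2) (r' := 0) (by decide) (by decide) (by decide)] at h3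
  have h8 : Module.finrank k ↥(g.Vzero a 0 ⊓ g.Vzero a 1) = Module.finrank k (g.Vcozero a 2) := by
    rw [Vzero_inf_Vzero (g := g) (r' := 2) (by decide) (by decide) (by decide)]
  have h9 : Module.finrank k ↥(g.Vzero a 0 ⊓ g.Vzero a 2) = Module.finrank k (g.Vcozero a 1) := by
    rw [Vzero_inf_Vzero (g := g) (r' := 1) (by decide) (by decide) (by decide)]
  -- The defect is the codimension of the right side of the distributive law in the left; `hle`
  -- keeps the subtraction from being truncated.
  refine ⟨Module.finrank k ↥(g.Vzero a 0 ⊓ (g.Vzero a 1 ⊔ g.Vzero a 2)) -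
    Module.finrank k ↥((g.Vzero a 0 ⊓ g.Vzero a 1) ⊔ (g.Vzero a 0 ⊓ g.Vzero a 2)), ?_, ?_⟩
  · rw [Fin.sum_univ_three, Fin.sum_univ_three]
    omega
  · constructor
    · intro h
      exact (h7 (by omega)).symm
    · intro h
      have h' : g.Vzero a 0 ⊓ (g.Vzero a 1 ⊔ g.Vzero a 2) = _ := h
      rw [h', Nat.sub_self]

end LimitLinearSeries

/-! ### Telescoping of the inclusion-exclusion numbers -/

theorem MultiDegree.sum_eq_sum_range {d : ℕ} (F : ℕ → ℕ → ℤ) :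
    ∑ a : MultiDegree d, F (a.1 0) (a.1 2) =
      ∑ i ∈ Finset.range (d + 1), ∑ l ∈ Finset.range (d + 1 - i), F i l := by
  rw [Finset.sum_sigma']
  refine Finset.sum_bij (fun a _ => ⟨a.1 0, a.1 2⟩) (fun a _ => ?_) (fun a _ b _ h => ?_)
    (fun x hx => ?_) (fun a _ => rfl)
  · have := a.sum_eq
    simp only [Finset.mem_sigma, Finset.mem_range]
    omega
  · obtain ⟨h1, h2⟩ := Sigma.mk.inj_iff.mp h
    exact MultiDegree.ext' h1 (eq_of_heq h2)
  · simp only [Finset.mem_sigma, Finset.mem_range] at hx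
    exact ⟨.mk' x.1 x.2 (by omega), Finset.mem_univ _, rfl⟩

/-- For fixed i the sum over l telescopes; the contributions of its lower end l = 0 then telescope
in i. -/
theorem sum_mixed_difference (d : ℕ) (H : ℕ → ℕ → ℤ) :
    ∑ a : MultiDegree d, (H (a.1 0 + 1) (a.1 2 + 1) - H (a.1 0) (a.1 2 + 1) -
      H (a.1 0 + 1) (a.1 2) + H (a.1 0) (a.1 2)) =
    ∑ i ∈ Finset.range (d + 1), (H (i + 1) (d + 1 - i) - H i (d + 1 - i)) -
      (H (d + 1) 0 - H 0 0) := by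
  rw [MultiDegree.sum_eq_sum_range fun i l => H (i + 1) (l + 1) - H i (l + 1) - H (i + 1) l + H i l,
    ← Finset.sum_range_sub (fun i => H i 0), ← Finset.sum_sub_distrib]
  refine Finset.sum_congr rfl fun i _ => ?_
  rw [← Finset.sum_range_sub (fun l => H (i + 1) l - H i l)]
  exact Finset.sum_congr rfl fun l _ => by ring

namespace LimitLinearSeries

variable {X : ChainCurve k} {d r : ℕ} (g : LimitLinearSeries X d r)

/-- The function whose mixed differences are the values of the inclusion-exclusion formula. -/
noncomputable def potential : ℕ → ℕ → ℤ
  -- Indices are shifted by one, so that the rows i = 0 and l = 0 hold boundary values. These, and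
  -- the value -(r + 1) beyond degree d, are chosen so that the mixed difference formula also holds
  -- on the edges of the triangle.
  | 0, 0 => -(r + 1)
  | 0, l + 1 => if h : 0 + (l + 1) ≤ d then -Module.finrank k (g.Vcozero (.mk' 0 (l + 1) h) 2)
      else -(r + 1)
  | i + 1, 0 => if h : i + 1 + 0 ≤ d then -Module.finrank k (g.Vcozero (.mk' (i + 1) 0 h) 0)
      else -(r + 1)
  | i + 1, l + 1 => if h : i + l ≤ d then Module.finrank k (g.Vcozero (.mk' i l h) 1) else 0

variable {g}

theorem potential_succ_succ {b : MultiDegree d} {i l : ℕ} (h0 : i = b.1 0 + 1)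
    (h2 : l = b.1 2 + 1) : g.potential i l = Module.finrank k (g.Vcozero b 1) := by
  have := b.sum_eq
  subst h0 h2
  rw [potential, dif_pos (by omega)]
  have hb : MultiDegree.mk' (b.1 0) (b.1 2) (by omega) = b := MultiDegree.ext' rfl rfl
  rw [hb]

theorem potential_zero_succ {b : MultiDegree d} {l : ℕ} (h0 : b.1 0 = 0) (h2 : b.1 2 = l)
    (hl : l ≠ 0) : g.potential 0 l = -Module.finrank k (g.Vcozero b 2) := by
  have := b.sum_eq
  obtain ⟨l, rfl⟩ := Nat.exists_eq_succ_of_ne_zero hl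
  rw [Nat.succ_eq_add_one, potential, dif_pos (by omega)]
  have hb : MultiDegree.mk' 0 (l + 1) (by omega) = b := MultiDegree.ext' h0.symm h2.symm
  rw [hb]

theorem potential_succ_zero {b : MultiDegree d} {i : ℕ} (h0 : b.1 0 = i) (h2 : b.1 2 = 0)
    (hi : i ≠ 0) : g.potential i 0 = -Module.finrank k (g.Vcozero b 0) := by
  have := b.sum_eq
  obtain ⟨i, rfl⟩ := Nat.exists_eq_succ_of_ne_zero hi
  rw [Nat.succ_eq_add_one, potential, dif_pos (by omega)]
  have hb : MultiDegree.mk' (i + 1) 0 (by omega) = b := MultiDegree.ext' h0.symm h2.symm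
  rw [hb]

theorem potential_zero_add_one (hg : g.IsExact) {a : MultiDegree d} (h0 : a.1 0 = 0) :
    g.potential 0 (a.1 2 + 1) = Module.finrank k (g.Vzero a 2) - (r + 1) := by
  have ha := a.sum_eq
  by_cases h1 : a.1 1 = 0
  · have hbot : g.Vzero a 2 = ⊥ := by
      rw [eq_bot_iff]
      intro s hs
      have hs1 := Vzero_two_le_one h1 hs
      have hs0 := Vzero_one_le_zero h0 hs1
      exact eq_zero_of_mem_Vzero (g := g) fun q => by fin_cases q; exacts [hs0, hs1, hs]
    rw [potential, dif_neg (by omega), hbot, finrank_bot]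
    simp
  · have hb : IsTwist 2 (.mk' 0 (a.1 2 + 1) (by omega)) a := by
      rw [isTwist_two_iff]; simp; omega
    have h := finrank_Vzero_add hg hb
    rw [potential_zero_succ (b := .mk' 0 (a.1 2 + 1) (by omega)) (l := a.1 2 + 1)
      rfl rfl (by omega)]
    omega

theorem potential_add_one_zero (hg : g.IsExact) {a : MultiDegree d} (h2 : a.1 2 = 0) :
    g.potential (a.1 0 + 1) 0 = Module.finrank k (g.Vzero a 0) - (r + 1) := by
  have ha := a.sum_eq
  by_cases h1 : a.1 1 = 0
  · have hbot : g.Vzero a 0 = ⊥ := by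
      rw [eq_bot_iff]
      intro s hs
      have hs1 := Vzero_zero_le_one h1 hs
      have hs2 := Vzero_one_le_two h2 hs1
      exact eq_zero_of_mem_Vzero (g := g) fun q => by fin_cases q; exacts [hs, hs1, hs2]
    rw [potential, dif_neg (by omega), hbot, finrank_bot]
    simp
  · have hb : IsTwist 0 (.mk' (a.1 0 + 1) 0 (by omega)) a := by
      rw [isTwist_zero_iff]; simp; omega
    have h := finrank_Vzero_add hg hb
    rw [potential_succ_zero (b := .mk' (a.1 0 + 1) 0 (by omega)) (i := a.1 0 + 1)
      rfl rfl (by omega)]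
    omega

/-- In the interior, rank-nullity turns dim V_a^{X_3,0} - dim V_a^{X_1^c,0}, dim V_a^{X_1,0} - dim
V_a^{X_3^c,0} and r + 1 - dim V_a^{X_2,0} into dimensions of spaces V^{X_2^c,0} in the multidegrees
a + e_1, a + e_3 and a - e_2. On the edges, degree zero on an end component makes sections vanishing
on X_2 vanish there too. -/
theorem inclusion_exclusion_eq_mixed_difference (hg : g.IsExact) (a : MultiDegree d) :
    (r + 1 - ∑ q, (Module.finrank k (g.Vzero a q) : ℤ) +
      ∑ q, (Module.finrank k (g.Vcozero a q) : ℤ)) =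
    g.potential (a.1 0 + 1) (a.1 2 + 1) - g.potential (a.1 0) (a.1 2 + 1) -
      g.potential (a.1 0 + 1) (a.1 2) + g.potential (a.1 0) (a.1 2) := by
  have ha := a.sum_eq
  rw [Fin.sum_univ_three, Fin.sum_univ_three, potential_succ_succ (b := a) rfl rfl]
  by_cases h0 : a.1 0 = 0 <;> by_cases h2 : a.1 2 = 0
  · have e1 := potential_zero_add_one hg h0
    have e2 := potential_add_one_zero hg h2
    have e3 : g.potential 0 0 = -(r + 1) := by rw [potential]
    have e4 : g.Vzero a 1 = ⊥ := by
      rw [eq_bot_iff]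
      intro s hs
      have hs0 := Vzero_one_le_zero h0 hs
      have hs2 := Vzero_one_le_two h2 hs
      exact eq_zero_of_mem_Vzero (g := g) fun q => by fin_cases q; exacts [hs0, hs, hs2]
    rw [Vcozero_zero_eq_bot h0, Vcozero_two_eq_bot h2, e4]
    simp only [finrank_bot, h0, h2] at *
    rw [e1, e2, e3]
    push_cast
    ring
  · have e1 := potential_zero_add_one hg h0
    have e2 : g.Vzero a 1 = g.Vcozero a 2 := by
      rw [← Vzero_inf_Vzero (g := g) (p := 0) (q := 1) (by decide) (by decide) (by decide)]
      exact (inf_eq_right.mpr (Vzero_one_le_zero h0)).symm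
    have t : IsTwist 2 a (.mk' 0 (a.1 2 - 1) (by omega)) := by
      rw [isTwist_two_iff]; simp; omega
    have e3 := finrank_Vzero_eq hg (p := 0) (r' := 1) (by decide) (by decide) (by decide) t
    have e4 := potential_succ_succ (g := g) (b := .mk' 0 (a.1 2 - 1) (by omega))
      (i := 0 + 1) (l := a.1 2) (by simp) (by simp; omega)
    have e5 := potential_zero_succ (g := g) h0 rfl h2
    rw [Vcozero_zero_eq_bot h0, finrank_bot, e2, h0, e1, e4, e5]
    omega
  · have e1 := potential_add_one_zero hg h2
    have e2 : g.Vzero a 1 = g.Vcozero a 0 := by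
      rw [← Vzero_inf_Vzero (g := g) (p := 1) (q := 2) (by decide) (by decide) (by decide)]
      exact (inf_eq_left.mpr (Vzero_one_le_two h2)).symm
    have t : IsTwist 0 a (.mk' (a.1 0 - 1) 0 (by omega)) := by
      rw [isTwist_zero_iff]; simp; omega
    have e3 := finrank_Vzero_eq hg (p := 2) (r' := 1) (by decide) (by decide) (by decide) t
    have e4 := potential_succ_succ (g := g) (b := .mk' (a.1 0 - 1) 0 (by omega))
      (i := a.1 0) (l := 0 + 1) (by simp; omega) (by simp)
    have e5 := potential_succ_zero (g := g) rfl h2 h0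
    rw [Vcozero_two_eq_bot h2, finrank_bot, e2, h2, e1, e4, e5]
    omega
  · have t0 : IsTwist 0 a (.mk' (a.1 0 - 1) (a.1 2) (by omega)) := by
      rw [isTwist_zero_iff]; simp; omega
    have t2 : IsTwist 2 a (.mk' (a.1 0) (a.1 2 - 1) (by omega)) := by
      rw [isTwist_two_iff]; simp; omega
    have t1 : IsTwist 1 (.mk' (a.1 0 - 1) (a.1 2 - 1) (by omega)) a := by
      rw [isTwist_one_iff]; simp; omega
    have e0 := finrank_Vzero_eq hg (p := 2) (r' := 1) (by decide) (by decide) (by decide) t0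
    have e2 := finrank_Vzero_eq hg (p := 0) (r' := 1) (by decide) (by decide) (by decide) t2
    have e1 := finrank_Vzero_add hg t1
    rw [potential_succ_succ (g := g) (b := .mk' (a.1 0 - 1) (a.1 2) (by omega))
        (i := a.1 0) (l := a.1 2 + 1) (by simp; omega) (by simp),
      potential_succ_succ (g := g) (b := .mk' (a.1 0) (a.1 2 - 1) (by omega))
        (i := a.1 0 + 1) (l := a.1 2) (by simp) (by simp; omega),
      potential_succ_succ (g := g) (b := .mk' (a.1 0 - 1) (a.1 2 - 1) (by omega))
        (i := a.1 0) (l := a.1 2) (by simp; omega) (by simp; omega)]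
    omega

theorem sum_inclusion_exclusion (hg : g.IsExact) :
    ∑ a : MultiDegree d, (r + 1 - ∑ q, (Module.finrank k (g.Vzero a q) : ℤ) +
      ∑ q, (Module.finrank k (g.Vcozero a q) : ℤ)) = r + 1 := by
  rw [Finset.sum_congr rfl fun a _ => inclusion_exclusion_eq_mixed_difference hg a,
    sum_mixed_difference, Finset.sum_range_succ']
  -- Along the hypotenuse the two terms belong to multidegrees with middle entry 0 and 1, where
  -- V^{X_2^c,0} = 0.
  have e1 : ∀ i ∈ Finset.range d, g.potential (i + 1 + 1) (d + 1 - (i + 1)) -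
      g.potential (i + 1) (d + 1 - (i + 1)) = 0 := by
    intro i hi
    have hi := Finset.mem_range.mp hi
    rw [potential_succ_succ (b := .mk' (i + 1) (d - (i + 1)) (by omega)) (i := i + 1 + 1)
        (l := d + 1 - (i + 1)) rfl (by simp; omega),
      potential_succ_succ (b := .mk' i (d - (i + 1)) (by omega)) (i := i + 1)
        (l := d + 1 - (i + 1)) rfl (by simp; omega),
      Vcozero_one_eq_bot (by simp), Vcozero_one_eq_bot (by simp; omega)]
    simp
  rw [Finset.sum_eq_zero e1, potential_succ_succ (b := .mk' 0 d (by omega))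
      (i := 0 + 1) (l := d + 1 - 0) rfl (by simp),
    Vcozero_one_eq_bot (by simp)]
  have e2 : g.potential 0 (d + 1 - 0) = -(r + 1) := by
    rw [Nat.sub_zero, potential, dif_neg (by omega)]
  have e3 : g.potential (d + 1) 0 = -(r + 1) := by rw [potential, dif_neg (by omega)]
  have e4 : g.potential 0 0 = -(r + 1) := by rw [potential]
  rw [e2, e3, e4]
  simp

theorem sum_quotientDim (hg : g.IsExact) : ∃ δ : MultiDegree d → ℕ,
    ∑ a : MultiDegree d, g.quotientDim a = r + 1 + ∑ a, δ a ∧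
      ∀ a, δ a = 0 ↔ g.DistributivityHolds a := by
  choose δ h1 h2 using fun a => exists_quotientDim_eq (g := g) a
  refine ⟨δ, ?_, h2⟩
  have h := sum_inclusion_exclusion hg
  zify
  rw [Finset.sum_congr rfl fun a _ => h1 a, Finset.sum_add_distrib, h]

theorem sum_quotientDim_eq_iff (hg : g.IsExact) :
    ∑ a : MultiDegree d, g.quotientDim a = r + 1 ↔ ∀ a, g.DistributivityHolds a := by
  obtain ⟨δ, h1, h2⟩ := sum_quotientDim hg
  simp only [h1, ← h2, Nat.add_eq_left, Finset.sum_eq_zero_iff, Finset.mem_univ, true_imp_iff]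

theorem le_sum_quotientDim (hg : g.IsExact) :
    r + 1 ≤ ∑ a : MultiDegree d, g.quotientDim a := by
  obtain ⟨δ, h1, -⟩ := sum_quotientDim hg
  omega

theorem H0map_pathMap_cons {a b c : MultiDegree d} (e : Step a b) (π : Path b c)
    (s : X.H0 (g.L a)) : X.H0map (g.pathMap (.cons e π)) s =
      X.H0map (g.pathMap π) (X.H0map (g.stepMap e) s) := rfl

theorem H0map_stepMap_mem {a b : MultiDegree d} (e : Step a b) {s : X.H0 (g.L a)}
    (hs : s ∈ g.V a) : X.H0map (g.stepMap e) s ∈ g.V b := by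
  cases e with
  | up q h => exact g.link_up q h ⟨s, hs, rfl⟩
  | down q h => exact g.link_down q h ⟨s, hs, rfl⟩

theorem H0map_pathMap_mem {a b : MultiDegree d} (π : Path a b) {s : X.H0 (g.L a)}
    (hs : s ∈ g.V a) : X.H0map (g.pathMap π) s ∈ g.V b := by
  induction π with
  | nil a => exact hs
  | cons e π ih => exact ih (H0map_stepMap_mem e hs)

theorem H0map_pathMap_mem_Vzero {a b : MultiDegree d} (π : Path a b) {c : Fin 3}
    (hc : π.Kills c) {s : X.H0 (g.L a)} (hs : s ∈ g.V a) :
    X.H0map (g.pathMap π) s ∈ g.Vzero b c :=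
  ⟨H0map_pathMap_mem π hs, (g.vanishesOn_pathMap_iff π c s).mpr (.inl hc)⟩

theorem H0map_pathMap_eq_zero {a b : MultiDegree d} (π : Path a b) (hπ : ∀ c, π.Kills c)
    {s : X.H0 (g.L a)} (hs : s ∈ g.V a) : X.H0map (g.pathMap π) s = 0 :=
  eq_zero_of_mem_Vzero fun c => H0map_pathMap_mem_Vzero π (hπ c) hs

theorem Vzero_le_sup (a : MultiDegree d) (q : Fin 3) :
    g.Vzero a q ≤ g.Vzero a 0 ⊔ g.Vzero a 1 ⊔ g.Vzero a 2 := by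
  fin_cases q
  · exact le_sup_left.trans le_sup_left
  · exact le_sup_right.trans le_sup_left
  · exact le_sup_right

/-! ### Simple limit linear series -/

/-- A path between different multidegrees has a step, and every step kills some component. -/
theorem H0map_φ_mem_sup {a b : MultiDegree d} (hab : a ≠ b) {s : X.H0 (g.L a)} (hs : s ∈ g.V a) :
    X.H0map (g.φ a b) s ∈ g.Vzero b 0 ⊔ g.Vzero b 1 ⊔ g.Vzero b 2 := by
  obtain ⟨c, hc⟩ : ∃ c, (exists_admissible a b).choose.Kills c := by
    generalize (exists_admissible a b).choose = π
    cases π with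
    | nil a => exact (hab rfl).elim
    | cons e π =>
      obtain ⟨c, hc⟩ := e.exists_kills
      exact ⟨c, .inl hc⟩
  exact Vzero_le_sup b c (H0map_pathMap_mem_Vzero _ hc hs)

theorem IsSimple.sum_quotientDim_le (h : g.IsSimple) :
    ∑ a : MultiDegree d, g.quotientDim a ≤ r + 1 := by
  classical
  obtain ⟨m, δ, ρ, s, hV, -, hbasis⟩ := h
  have hle (a : MultiDegree d) : g.quotientDim a ≤ ∑ α with δ α = a, ρ α := by
    let F := fun x : (Σ α : Fin m, Fin (ρ α)) => X.H0map (g.φ (δ x.1) a) (s x.1 x.2)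
    let I := {x : (Σ α : Fin m, Fin (ρ α)) // δ x.1 = a}
    have hI : Fintype.card I = ∑ α with δ α = a, ρ α := by
      rw [Fintype.card_subtype, Finset.sum_filter]
      simp only [Finset.card_filter, Fintype.sum_sigma]
      refine Finset.sum_congr rfl fun α _ => ?_
      split_ifs <;> simp
    have hsup : g.V a ≤ Submodule.span k (Set.range fun x : I => F x.1) ⊔
        (g.Vzero a 0 ⊔ g.Vzero a 1 ⊔ g.Vzero a 2) := by
      rw [← (hbasis a).2, Submodule.span_le]
      rintro _ ⟨x, rfl⟩
      by_cases hx : δ x.1 = a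
      · exact Submodule.mem_sup_left (Submodule.subset_span ⟨⟨x, hx⟩, rfl⟩)
      · exact Submodule.mem_sup_right (H0map_φ_mem_sup hx (hV x.1 x.2))
    have hfin : FiniteDimensional k (Submodule.span k (Set.range fun x : I => F x.1)) :=
      FiniteDimensional.span_of_finite k (Set.finite_range _)
    have h1 := (Submodule.finrank_mono hsup).trans (Submodule.finrank_add_le_finrank_add_finrank _ _)
    have h2 := finrank_range_le_card (R := k) (fun x : I => F x.1)
    rw [Set.finrank, hI] at h2
    have h3 := quotientDim_add_finrank (g := g) a
    rw [g.finrank_V] at h1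
    omega
  calc ∑ a, g.quotientDim a ≤ ∑ a, ∑ α with δ α = a, ρ α := Finset.sum_le_sum fun a _ => hle a
    _ = ∑ α, ρ α := Finset.sum_fiberwise _ _ _
    _ = r + 1 := by
      -- Any multidegree would serve to count the sections of the simple basis.
      obtain ⟨hli, hsp⟩ := hbasis (.mk' 0 0 (Nat.zero_le d))
      have h := finrank_span_eq_card hli
      rw [hsp, g.finrank_V] at h
      simpa using h.symm

/-! ### Construction of a simple basis -/

/-- Exactness applies to the step down from a + e_q. If a + e_q has a negative entry, the degree of
a on X_q is less than the number of points where X_q meets the other components. -/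
theorem Vcozero_le_map_step (hg : g.IsExact) (a : MultiDegree d) (q : Fin 3) :
    g.Vcozero a q = ⊥ ∨ ∃ (b : MultiDegree d) (e : Step b a),
      g.Vcozero a q = (g.V b).map (X.H0map (g.stepMap e)) := by
  have ha := a.sum_eq
  suffices h : g.Vcozero a q = ⊥ ∨ ∃ b, IsTwist q a b by
    refine h.imp_right fun ⟨b, hb⟩ => ⟨b, .down q hb, (map_down hg hb).symm⟩
  fin_cases q
  · by_cases h0 : a.1 0 = 0
    · exact .inl (Vcozero_zero_eq_bot h0)
    · refine .inr ⟨.mk' (a.1 0 - 1) (a.1 2) (by omega), isTwist_zero_iff.mpr ?_⟩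
      simp; omega
  · by_cases h1 : a.1 1 ≤ 1
    · exact .inl (Vcozero_one_eq_bot h1)
    · refine .inr ⟨.mk' (a.1 0 + 1) (a.1 2 + 1) (by omega), isTwist_one_iff.mpr ?_⟩
      simp; omega
  · by_cases h2 : a.1 2 = 0
    · exact .inl (Vcozero_two_eq_bot h2)
    · refine .inr ⟨.mk' (a.1 0) (a.1 2 - 1) (by omega), isTwist_two_iff.mpr ?_⟩
      simp; omega

/-- If a - e_q is not a multidegree, some component has degree zero in a and forces sections
vanishing on X_q to vanish on a second component; the previous lemma then applies. -/
theorem Vzero_le_map_step (hg : g.IsExact) (a : MultiDegree d) (q : Fin 3) :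
    g.Vzero a q = ⊥ ∨ ∃ (b : MultiDegree d) (e : Step b a),
      g.Vzero a q ≤ (g.V b).map (X.H0map (g.stepMap e)) := by
  have ha := a.sum_eq
  suffices h : (∃ p, g.Vzero a q ≤ g.Vcozero a p) ∨ ∃ b, IsTwist q b a by
    rcases h with ⟨p, hp⟩ | ⟨b, hb⟩
    · rcases Vcozero_le_map_step hg a p with h | ⟨b, e, h⟩
      · exact .inl (eq_bot_iff.mpr (h ▸ hp))
      · exact .inr ⟨b, e, h ▸ hp⟩
    · exact .inr ⟨b, .up q hb, (map_up hg hb).ge⟩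
  have hle {p p' q' : Fin 3} (h1 : p ≠ p') (h2 : p ≠ q') (h3 : p' ≠ q')
      (h : g.Vzero a p ≤ g.Vzero a p') : ∃ q, g.Vzero a p ≤ g.Vcozero a q :=
    ⟨q', (le_inf le_rfl h).trans (Vzero_inf_Vzero h1 h2 h3 a).le⟩
  fin_cases q
  · by_cases h1 : a.1 1 = 0
    · exact .inl (hle (q' := 2) (by decide) (by decide) (by decide) (Vzero_zero_le_one h1))
    · refine .inr ⟨.mk' (a.1 0 + 1) (a.1 2) (by omega), isTwist_zero_iff.mpr ?_⟩
      simp; omega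
  · by_cases h0 : a.1 0 = 0
    · exact .inl (hle (q' := 2) (by decide) (by decide) (by decide) (Vzero_one_le_zero h0))
    by_cases h2 : a.1 2 = 0
    · exact .inl (hle (q' := 0) (by decide) (by decide) (by decide) (Vzero_one_le_two h2))
    · refine .inr ⟨.mk' (a.1 0 - 1) (a.1 2 - 1) (by omega), isTwist_one_iff.mpr ?_⟩
      simp; omega
  · by_cases h1 : a.1 1 = 0
    · exact .inl (hle (q' := 0) (by decide) (by decide) (by decide) (Vzero_two_le_one h1))
    · refine .inr ⟨.mk' (a.1 0) (a.1 2 + 1) (by omega), isTwist_two_iff.mpr ?_⟩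
      simp; omega

/-- If `C a` and the three subspaces `V_a^{X_q,0}` span `V_a` for every `a`, then the images of the
`C a` under the linking maps span `V_b`. -/
theorem map_pathMap_le (hg : g.IsExact) (C : ∀ a, Set (X.H0 (g.L a)))
    (hC : ∀ a, g.V a ≤ Submodule.span k (C a) ⊔ (g.Vzero a 0 ⊔ g.Vzero a 1 ⊔ g.Vzero a 2))
    {b : MultiDegree d} (T : Submodule k (X.H0 (g.L b)))
    (hT : ∀ a, ∀ s ∈ C a, X.H0map (g.φ a b) s ∈ T) (n : ℕ) :
    ∀ {a : MultiDegree d} (π : Path a b) {c : Fin 3}, ¬ π.Kills c → 6 * d < π.length + n →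
      (g.V a).map (X.H0map (g.pathMap π)) ≤ T := by
  induction n with
  | zero =>
    intro a π c hc hn
    have := π.length_le hc
    omega
  | succ n ih =>
    intro a π c hc hn
    rw [Submodule.map_le_iff_le_comap]
    refine (hC a).trans (sup_le (Submodule.span_le.mpr fun s hs => ?_) ?_)
    · rw [SetLike.mem_coe, Submodule.mem_comap, g.pathMap_eq_φ π hc]
      exact hT a s hs
    · have key (q : Fin 3) : g.Vzero a q ≤ T.comap (X.H0map (g.pathMap π)) := by
        rcases Vzero_le_map_step hg a q with h | ⟨a', e, h⟩
        · rw [h]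
          exact bot_le
        · refine h.trans ?_
          rintro _ ⟨s, hs, rfl⟩
          rw [Submodule.mem_comap, ← H0map_pathMap_cons]
          -- Extending the path backwards by `e` gives either the zero map on sections of the series
          -- or a longer path still sparing some component.
          by_cases hk : ∀ c, (Path.cons e π).Kills c
          · rw [H0map_pathMap_eq_zero _ hk hs]
            exact T.zero_mem
          · push Not at hk
            obtain ⟨c', hc'⟩ := hk
            exact ih (.cons e π) hc' (by rw [Path.length]; omega) ⟨s, hs, rfl⟩
      exact sup_le (sup_le (key 0) (key 1)) (key 2)

theorem exists_lift_basis (a : MultiDegree d) : ∃ s : Fin (g.quotientDim a) → X.H0 (g.L a),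
    (∀ j, s j ∈ g.V a) ∧ LinearIndependent k s ∧
      g.V a ≤ Submodule.span k (Set.range s) ⊔ (g.Vzero a 0 ⊔ g.Vzero a 1 ⊔ g.Vzero a 2) := by
  let N := Submodule.submoduleOf (g.Vzero a 0 ⊔ g.Vzero a 1 ⊔ g.Vzero a 2) (g.V a)
  let B : Module.Basis (Fin (g.quotientDim a)) k (g.V a ⧸ N) := Module.finBasis k (g.V a ⧸ N)
  choose t ht using fun j => N.mkQ_surjective (B j)
  have hli : LinearIndependent k t := by
    refine LinearIndependent.of_comp N.mkQ ?_
    convert B.linearIndependent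
    exact funext ht
  refine ⟨fun j => t j, fun j => (t j).2, hli.map' (g.V a).subtype (Submodule.ker_subtype _), ?_⟩
  intro v hv
  have h1 : N.mkQ ⟨v, hv⟩ ∈ Submodule.span k (Set.range B) := by rw [B.span_eq]; trivial
  have hB : Set.range B = N.mkQ '' Set.range t := by
    rw [← Set.range_comp]
    exact congrArg Set.range (funext fun j => (ht j).symm)
  rw [hB, ← Submodule.map_span] at h1
  obtain ⟨w, hw, hwv⟩ := h1
  have h2 : (⟨v, hv⟩ : g.V a) - w ∈ N := by
    rw [← Submodule.Quotient.eq]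
    exact hwv.symm
  have h3 : (w : X.H0 (g.L a)) ∈ Submodule.span k (Set.range fun j => (t j : X.H0 (g.L a))) := by
    have : (Set.range fun j => (t j : X.H0 (g.L a))) = (g.V a).subtype '' Set.range t := by
      rw [← Set.range_comp]
      rfl
    rw [this, ← Submodule.map_span]
    exact ⟨w, hw, rfl⟩
  exact Submodule.mem_sup.mpr ⟨w, h3, v - w, h2, add_sub_cancel _ _⟩

theorem isSimple_of_sum_quotientDim (hg : g.IsExact)
    (h : ∑ a : MultiDegree d, g.quotientDim a = r + 1) : g.IsSimple := by
  choose s hsV hsli hsspan using fun a => exists_lift_basis (g := g) a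
  let e := (Fintype.equivFin (MultiDegree d)).symm
  refine ⟨_, e, fun α => g.quotientDim (e α), fun α => s (e α), fun α => hsV _, fun α => hsli _,
    fun b => ?_⟩
  set F := fun x : (Σ α, Fin (g.quotientDim (e α))) => X.H0map (g.φ (e x.1) b) (s (e x.1) x.2)
    with hF
  have hspan : Submodule.span k (Set.range F) = g.V b := by
    apply le_antisymm
    · rw [Submodule.span_le]
      rintro _ ⟨x, rfl⟩
      exact H0map_pathMap_mem _ (hsV _ _)
    -- The empty path has length zero, so 6d + 1 rounds of the induction exceed the length of every
    -- path that spares a component.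
    · have h1 := map_pathMap_le hg (fun a => Set.range (s a)) hsspan
        (Submodule.span k (Set.range F)) ?_ (6 * d + 1) (.nil b) (c := 0) (fun h => h) (by omega)
      · exact fun v hv => h1 ⟨v, hv, rfl⟩
      · rintro a _ ⟨j, rfl⟩
        obtain ⟨α, rfl⟩ := e.surjective a
        exact Submodule.subset_span ⟨⟨α, j⟩, rfl⟩
  refine ⟨?_, hspan⟩
  -- By hypothesis there are r + 1 sections, and they span a space of that dimension, so they are
  -- independent.
  rw [linearIndependent_iff_card_eq_finrank_span, Set.finrank, hspan, g.finrank_V,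
    Fintype.card_sigma, ← h]
  simp only [Fintype.card_fin]
  exact e.sum_comp fun a => g.quotientDim a

theorem isSimple_iff (hg : g.IsExact) :
    g.IsSimple ↔ ∑ a : MultiDegree d, g.quotientDim a = r + 1 :=
  ⟨fun h => le_antisymm h.sum_quotientDim_le (le_sum_quotientDim hg),
    isSimple_of_sum_quotientDim hg⟩

end LimitLinearSeries

end LimitSeries

theorem mainTheorem1 {k : Type u} [Field k] [IsAlgClosed k] (X : LimitSeries.ChainCurve k)
    (d r : ℕ) (g : LimitSeries.LimitLinearSeries X d r) (hg : g.IsExact) :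
    List.TFAE [g.IsSimple,
      ∑ a : LimitSeries.MultiDegree d, g.quotientDim a = r + 1,
      ∀ a : LimitSeries.MultiDegree d, g.DistributivityHolds a] := by
  tfae_have 1 ↔ 2 := LimitSeries.LimitLinearSeries.isSimple_iff hg
  tfae_have 2 ↔ 3 := LimitSeries.LimitLinearSeries.sum_quotientDim_eq_iff hg
  tfae_finish
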